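/- Fix finite sets of measurement settings $x,y,z$ and of outcomes $\alpha,\beta,\gamma$ for three parties Alice, Bob, Charlie, and numbers $p(\alpha\beta\gamma|xyz)$. All $C^*$-algebras are unital and all $C^*$-subalgebras contain the unit of the ambient algebra. A POVM is a finite family of positive elements summing to $\mathbb 1$; a state is a positive normalized linear functional; a density operator is a positive operator of trace one; $\otimes$ of Hilbert spaces is the Hilbert space tensor product; and $\mathcal M\bar\otimes\mathcal N$ is the closure, in the weak operator topology, of the algebraic tensor product of $\mathcal M$ and $\mathcal N$. In each model below, for all settings $x,y,z$ there are POVMs $\{A_{\alpha|x}\}_\alpha$, $\{B_{\beta|y}\}_\beta$, $\{C_{\gamma|z}\}_\gamma$. Consider the following models for $p$. 1. Tensor product model: there are Hilbert spaces $\mathcal H_A,\mathcal H_{B_A},\mathcal H_{B_C},\mathcal H_C$ with $A_{\alpha|x}\in B(\mathcal H_A)$, $B_{\beta|y}\in B(\mathcal H_{B_A})\bar\otimes B(\mathcal H_{B_C})$, $C_{\gamma|z}\in B(\mathcal H_C)$, and density operators $\sigma_{AB_A}$ on $\mathcal H_A\otimes\mathcal H_{B_A}$ and $\sigma_{B_CC}$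 on $\mathcal H_{B_C}\otimes\mathcal H_C$, such that $p(\alpha\beta\gamma|xyz)=\operatorname{tr}\big((\sigma_{AB_A}\otimes\sigma_{B_CC})(A_{\alpha|x}\otimes B_{\beta|y}\otimes C_{\gamma|z})\big)$. 2. Commuting observables model: there are a $C^*$-algebra $\mathcal D$, mutually commuting $C^*$-subalgebras $\mathcal A,\mathcal B_A,\mathcal B_C,\mathcal C\subset\mathcal D$ with $A_{\alpha|x}\in\mathcal A$, $C_{\gamma|z}\in\mathcal C$ and $B_{\beta|y}$ in the $C^*$-subalgebra generated by $\mathcal B_A$ and $\mathcal B_C$, and a state $\rho$ on $\mathcal D$ with $\rho(a\,b_A b_C\,c)=\rho(a\,b_A)\,\rho(b_C\,c)$ for all $a\in\mathcal A$, $b_A\in\mathcal B_A$, $b_C\in\mathcal B_C$, $c\in\mathcal C$, such that $p(\alpha\beta\gamma|xyz)=\rho(A_{\alpha|x}B_{\beta|y}C_{\gamma|z})$. 3. Reduced model: there are a $C^*$-algebra $\mathcal D$, mutually commuting $C^*$-subalgebras $\mathcal A,\mathcal B,\mathcal C\subset\mathcal D$ with $A_{\alpha|x}\in\mathcal A$,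 $B_{\beta|y}\in\mathcal B$, $C_{\gamma|z}\in\mathcal C$, and a state $\rho$ on $\mathcal D$ with $\rho(ac)=\rho(a)\rho(c)$ for all $a\in\mathcal A$, $c\in\mathcal C$, such that $p(\alpha\beta\gamma|xyz)=\rho(A_{\alpha|x}B_{\beta|y}C_{\gamma|z})$. 4. Mixed model: there are Hilbert spaces $\mathcal H_{AB_A},\mathcal H_{B_CC}$, commuting $C^*$-algebras $\mathcal A,\mathcal B_A\subset B(\mathcal H_{AB_A})$, commuting $C^*$-algebras $\mathcal B_C,\mathcal C\subset B(\mathcal H_{B_CC})$ with $A_{\alpha|x}\in\mathcal A$, $B_{\beta|y}\in\mathcal B_A\bar\otimes\mathcal B_C$, $C_{\gamma|z}\in\mathcal C$, and density operators $\sigma_{AB_A}$ on $\mathcal H_{AB_A}$ and $\sigma_{B_CC}$ on $\mathcal H_{B_CC}$, such that $p(\alpha\beta\gamma|xyz)=\operatorname{tr}\big((\sigma_{AB_A}\otimes\sigma_{B_CC})\,(A_{\alpha|x}\otimes\mathbb 1)\,B_{\beta|y}\,(\mathbb 1\otimes C_{\gamma|z})\big)$. 5. Renou–Xu model: there are a Hilbert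 space $\mathcal H$ on which all $A_{\alpha|x},B_{\beta|y},C_{\gamma|z}$ are bounded operators, operators of different parties commuting, and commuting orthogonal projections $P,Q\in B(\mathcal H)$ such that $PQ=|\psi\rangle\langle\psi|$ for a unit vector $\psi$, $[A_{\alpha|x},Q]=0$ and $[P,C_{\gamma|z}]=0$, such that $p(\alpha\beta\gamma|xyz)=\operatorname{tr}(PQ\,A_{\alpha|x}B_{\beta|y}C_{\gamma|z})$. Suppose that $p$ has a realization in at least one of these five models for which the $C^*$-algebra generated by Alice's operators $\{A_{\alpha|x}\}_{\alpha,x}$ and the $C^*$-algebra generated by Charlie's operators $\{C_{\gamma|z}\}_{\gamma,z}$ are both finite-dimensional. Then $p$ has a realization in each of the five models in which all Hilbert spaces and all operator algebras are finite-dimensional. -/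

import Mathlib

open scoped TensorProduct ComplexOrder

universe u v

namespace Bilocal

noncomputable section

/-! ### Hilbert space tensor products -/

/-- The Hilbert space tensor product: the completion of the algebraic tensor product with respect
to the inner product `⟪x ⊗ y, x' ⊗ y'⟫ = ⟪x, x'⟫ ⟪y, y'⟫`. -/
abbrev HTensor (E F : Type u) [NormedAddCommGroup E] [InnerProductSpace ℂ E]
    [NormedAddCommGroup F] [InnerProductSpace ℂ F] : Type u :=
  UniformSpace.Completion (E ⊗[ℂ] F)

/-- The bounded operator `f ⊗ g` on the Hilbert space tensor product, i.e. the continuous extension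
of `x ⊗ y ↦ f x ⊗ g y`. -/
def opTensor {E F : Type u} [NormedAddCommGroup E] [InnerProductSpace ℂ E]
    [NormedAddCommGroup F] [InnerProductSpace ℂ F]
    (f : E →L[ℂ] E) (g : F →L[ℂ] F) : HTensor E F →L[ℂ] HTensor E F :=
  (UniformSpace.Completion.toComplL.comp (TensorProduct.mapL f g)).extend
    (UniformSpace.Completion.toComplL : (E ⊗[ℂ] F) →L[ℂ] HTensor E F)

theorem opTensor_tmul {E F : Type u} [NormedAddCommGroup E] [InnerProductSpace ℂ E]
    [NormedAddCommGroup F] [InnerProductSpace ℂ F]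
    (f : E →L[ℂ] E) (g : F →L[ℂ] F) (x : E) (y : F) :
    opTensor f g ((x ⊗ₜ[ℂ] y : E ⊗[ℂ] F) : HTensor E F)
      = ((f x ⊗ₜ[ℂ] g y : E ⊗[ℂ] F) : HTensor E F) :=
  ContinuousLinearMap.extend_eq
    (e := (UniformSpace.Completion.toComplL : (E ⊗[ℂ] F) →L[ℂ] HTensor E F)) _
    UniformSpace.Completion.denseRange_coe
    (UniformSpace.Completion.isUniformInducing_coe _) (x ⊗ₜ[ℂ] y)

theorem denseRange_mapIsometry {E F G H : Type u}
    [NormedAddCommGroup E] [InnerProductSpace ℂ E] [NormedAddCommGroup F] [InnerProductSpace ℂ F]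
    [NormedAddCommGroup G] [InnerProductSpace ℂ G] [NormedAddCommGroup H] [InnerProductSpace ℂ H]
    (f : E →ₗᵢ[ℂ] G) (g : F →ₗᵢ[ℂ] H) (hf : DenseRange f) (hg : DenseRange g) :
    DenseRange (TensorProduct.mapIsometry f g) := by
  have key : ∀ z : G ⊗[ℂ] H,
      z ∈ (LinearMap.range (TensorProduct.mapIsometry f g).toLinearMap).topologicalClosure := by
    intro z
    induction z with
    | zero => exact Submodule.zero_mem _
    | add x y hx hy => exact Submodule.add_mem _ hx hy
    | tmul x y =>
      have hd : DenseRange (Prod.map f g) := hf.prodMap hg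
      have hc : Continuous fun q : G × H ↦ q.1 ⊗ₜ[ℂ] q.2 := TensorProduct.continuous_tmul
      refine hd.induction_on (p := fun q : G × H ↦ q.1 ⊗ₜ[ℂ] q.2 ∈
        (LinearMap.range (TensorProduct.mapIsometry f g).toLinearMap).topologicalClosure)
        (x, y) ?_ ?_
      · exact (Submodule.isClosed_topologicalClosure _).preimage hc
      · intro q
        exact Submodule.le_topologicalClosure _ ⟨q.1 ⊗ₜ[ℂ] q.2, rfl⟩
  intro z
  have := key z
  rw [← SetLike.mem_coe, Submodule.topologicalClosure_coe] at this
  exact this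

/-- The isometry `x ⊗ y ↦ f x ⊗ g y` from an algebraic tensor product to a Hilbert space tensor
product, for isometries `f` and `g`. -/
def embTensor {E F G H : Type u}
    [NormedAddCommGroup E] [InnerProductSpace ℂ E] [NormedAddCommGroup F] [InnerProductSpace ℂ F]
    [NormedAddCommGroup G] [InnerProductSpace ℂ G] [NormedAddCommGroup H] [InnerProductSpace ℂ H]
    (f : E →ₗᵢ[ℂ] G) (g : F →ₗᵢ[ℂ] H) : E ⊗[ℂ] F →ₗᵢ[ℂ] HTensor G H :=
  UniformSpace.Completion.toComplₗᵢ.comp (TensorProduct.mapIsometry f g)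

theorem denseRange_embTensor {E F G H : Type u}
    [NormedAddCommGroup E] [InnerProductSpace ℂ E] [NormedAddCommGroup F] [InnerProductSpace ℂ F]
    [NormedAddCommGroup G] [InnerProductSpace ℂ G] [NormedAddCommGroup H] [InnerProductSpace ℂ H]
    (f : E →ₗᵢ[ℂ] G) (g : F →ₗᵢ[ℂ] H) (hf : DenseRange f) (hg : DenseRange g) :
    DenseRange (embTensor f g) := by
  have h : DenseRange ((fun z : G ⊗[ℂ] H ↦ (z : HTensor G H)) ∘ TensorProduct.mapIsometry f g) :=
    DenseRange.comp UniformSpace.Completion.denseRange_coe (denseRange_mapIsometry f g hf hg)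
      (UniformSpace.Completion.continuous_coe _)
  exact h

/-- The canonical unitary `(E ⊗ F) ⊗ G ≃ E ⊗ (F ⊗ G)` of Hilbert space tensor products, extending
`(x ⊗ y) ⊗ z ↦ x ⊗ (y ⊗ z)`. -/
def assocUnitary (E F G : Type u)
    [NormedAddCommGroup E] [InnerProductSpace ℂ E] [NormedAddCommGroup F] [InnerProductSpace ℂ F]
    [NormedAddCommGroup G] [InnerProductSpace ℂ G] :
    HTensor (HTensor E F) G ≃ₗᵢ[ℂ] HTensor E (HTensor F G) :=
  (TensorProduct.assocIsometry ℂ E F G).toLinearEquiv.extendOfIsometry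
    (embTensor (UniformSpace.Completion.toComplₗᵢ : (E ⊗[ℂ] F) →ₗᵢ[ℂ] HTensor E F)
      (LinearIsometry.id : G →ₗᵢ[ℂ] G)).toLinearMap
    (embTensor (LinearIsometry.id : E →ₗᵢ[ℂ] E)
      (UniformSpace.Completion.toComplₗᵢ : (F ⊗[ℂ] G) →ₗᵢ[ℂ] HTensor F G)).toLinearMap
    (denseRange_embTensor _ _ UniformSpace.Completion.denseRange_coe
      Function.surjective_id.denseRange)
    (denseRange_embTensor _ _ Function.surjective_id.denseRange
      UniformSpace.Completion.denseRange_coe)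
    (fun x ↦ by
      rw [LinearIsometry.coe_toLinearMap, LinearIsometry.coe_toLinearMap,
        LinearIsometry.norm_map, LinearIsometry.norm_map]
      exact (TensorProduct.assocIsometry ℂ E F G).norm_map x)

theorem assocUnitary_tmul (E F G : Type u)
    [NormedAddCommGroup E] [InnerProductSpace ℂ E] [NormedAddCommGroup F] [InnerProductSpace ℂ F]
    [NormedAddCommGroup G] [InnerProductSpace ℂ G]
    (x : E) (y : F) (z : G) :
    assocUnitary E F G
        (((((x ⊗ₜ[ℂ] y : E ⊗[ℂ] F) : HTensor E F) ⊗ₜ[ℂ] z : (HTensor E F) ⊗[ℂ] G)) :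
          HTensor (HTensor E F) G)
      = ((x ⊗ₜ[ℂ] ((y ⊗ₜ[ℂ] z : F ⊗[ℂ] G) : HTensor F G) : E ⊗[ℂ] (HTensor F G)) :
          HTensor E (HTensor F G)) :=
  LinearEquiv.extendOfIsometry_eq (TensorProduct.assocIsometry ℂ E F G).toLinearEquiv
    (embTensor (UniformSpace.Completion.toComplₗᵢ : (E ⊗[ℂ] F) →ₗᵢ[ℂ] HTensor E F)
      (LinearIsometry.id : G →ₗᵢ[ℂ] G)).toLinearMap
    (embTensor (LinearIsometry.id : E →ₗᵢ[ℂ] E)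
      (UniformSpace.Completion.toComplₗᵢ : (F ⊗[ℂ] G) →ₗᵢ[ℂ] HTensor F G)).toLinearMap
    _ _ _ ((x ⊗ₜ[ℂ] y) ⊗ₜ[ℂ] z)

/-- The operator `T` transported along a unitary `U`, i.e. `U T U⁻¹`. -/
def conjBy {E F : Type u}
    [NormedAddCommGroup E] [InnerProductSpace ℂ E] [NormedAddCommGroup F] [InnerProductSpace ℂ F]
    (U : E ≃ₗᵢ[ℂ] F) (T : E →L[ℂ] E) : F →L[ℂ] F :=
  (U.toContinuousLinearEquiv : E →L[ℂ] F) ∘L T ∘L (U.symm.toContinuousLinearEquiv : F →L[ℂ] E)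

/-- The operator `a ⊗ b ⊗ c`, for `a` on `E`, `b` on `F ⊗ G` and `c` on `H`, acting on the
fourfold tensor product `E ⊗ F ⊗ G ⊗ H` bracketed as `(E ⊗ F) ⊗ (G ⊗ H)`: `b ⊗ c` is moved from
`(F ⊗ G) ⊗ H` to `F ⊗ (G ⊗ H)`, and `a ⊗ (b ⊗ c)` from `E ⊗ (F ⊗ (G ⊗ H))` to
`(E ⊗ F) ⊗ (G ⊗ H)`. -/
def opTensorMiddle {E F G H : Type u}
    [NormedAddCommGroup E] [InnerProductSpace ℂ E] [NormedAddCommGroup F] [InnerProductSpace ℂ F]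
    [NormedAddCommGroup G] [InnerProductSpace ℂ G] [NormedAddCommGroup H] [InnerProductSpace ℂ H]
    (a : E →L[ℂ] E) (b : HTensor F G →L[ℂ] HTensor F G) (c : H →L[ℂ] H) :
    HTensor (HTensor E F) (HTensor G H) →L[ℂ] HTensor (HTensor E F) (HTensor G H) :=
  conjBy (assocUnitary E F (HTensor G H)).symm
    (opTensor a (conjBy (assocUnitary F G H) (opTensor b c)))

/-! ### Traces and density operators -/

/-- `HasTrace T t`: the trace `∑ i, ⟪e i, T (e i)⟫` converges, with value `t`, in every
orthonormal basis `e` of `H`. -/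
def HasTrace {H : Type u} [NormedAddCommGroup H] [InnerProductSpace ℂ H]
    (T : H →L[ℂ] H) (t : ℂ) : Prop :=
  ∀ (ι : Type u) (e : HilbertBasis ι ℂ H), HasSum (fun i ↦ inner ℂ (e i) (T (e i))) t

/-- A density operator: a positive operator of trace one. -/
def IsDensityOperator {H : Type u} [NormedAddCommGroup H] [InnerProductSpace ℂ H]
    (σ : H →L[ℂ] H) : Prop :=
  σ.IsPositive ∧ HasTrace σ 1

/-! ### Algebras of observables -/

/-- A family `M` indexed by finitely many outcomes is a POVM if its members are positive and sum
to the identity. -/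
def IsPOVM {R : Type u} [CStarAlgebra R] {ι : Type v} [Fintype ι] (M : ι → R) : Prop :=
  (∀ i, ∃ b : R, M i = star b * b) ∧ ∑ i, M i = 1

/-- A state on a `C*`-algebra: a positive normalized linear functional. -/
def IsState {R : Type u} [CStarAlgebra R] (ρ : R →ₗ[ℂ] ℂ) : Prop :=
  (∀ b : R, 0 ≤ ρ (star b * b)) ∧ ρ 1 = 1

/-- Two sets of operators commute elementwise. -/
def MutuallyCommute {R : Type u} [Mul R] (S T : Set R) : Prop :=
  ∀ s ∈ S, ∀ t ∈ T, Commute s t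

/-- The (unital) `C*`-subalgebra generated by a set. -/
def generatedCStar {R : Type u} [CStarAlgebra R] (S : Set R) : StarSubalgebra ℂ R :=
  (StarAlgebra.adjoin ℂ S).topologicalClosure

/-- The `C*`-algebra generated by all members of all POVMs of one party. -/
def generatedByPOVMs {R : Type u} [CStarAlgebra R] {X α : Type v} (A : X → α → R) :
    StarSubalgebra ℂ R :=
  generatedCStar {a | ∃ x i, a = A x i}

/-- The von Neumann tensor product of two operator algebras: the closure, in the weak operator
topology, of the algebraic tensor product. -/
def vonNeumannTensor {E F : Type u}
    [NormedAddCommGroup E] [InnerProductSpace ℂ E] [CompleteSpace E]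
    [NormedAddCommGroup F] [InnerProductSpace ℂ F] [CompleteSpace F]
    (𝒜 : StarSubalgebra ℂ (E →L[ℂ] E)) (ℬ : StarSubalgebra ℂ (F →L[ℂ] F)) :
    Set (HTensor E F →L[ℂ] HTensor E F) :=
  {T | ContinuousLinearMap.WOTofCLM T ∈
    closure (ContinuousLinearMap.WOTofCLM ''
      (Submodule.span ℂ {S | ∃ a ∈ 𝒜, ∃ b ∈ ℬ, S = opTensor a b} :
        Set (HTensor E F →L[ℂ] HTensor E F)))}

/-! ### The five models of bilocal correlations -/

/-- A realization of `p(αβγ|xyz)` in the tensor product model. -/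
structure TensorModel {X Y Z α β γ : Type v} [Fintype α] [Fintype β] [Fintype γ]
    (p : α → β → γ → X → Y → Z → ℝ) where
  HA : Type u
  HBA : Type u
  HBC : Type u
  HC : Type u
  [normHA : NormedAddCommGroup HA]
  [innerHA : InnerProductSpace ℂ HA]
  [completeHA : CompleteSpace HA]
  [normHBA : NormedAddCommGroup HBA]
  [innerHBA : InnerProductSpace ℂ HBA]
  [completeHBA : CompleteSpace HBA]
  [normHBC : NormedAddCommGroup HBC]
  [innerHBC : InnerProductSpace ℂ HBC]
  [completeHBC : CompleteSpace HBC]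
  [normHC : NormedAddCommGroup HC]
  [innerHC : InnerProductSpace ℂ HC]
  [completeHC : CompleteSpace HC]
  A : X → α → (HA →L[ℂ] HA)
  B : Y → β → (HTensor HBA HBC →L[ℂ] HTensor HBA HBC)
  C : Z → γ → (HC →L[ℂ] HC)
  povmA : ∀ x, IsPOVM (A x)
  povmB : ∀ y, IsPOVM (B y)
  povmC : ∀ z, IsPOVM (C z)
  B_mem : ∀ y j, B y j ∈ vonNeumannTensor
    (⊤ : StarSubalgebra ℂ (HBA →L[ℂ] HBA)) (⊤ : StarSubalgebra ℂ (HBC →L[ℂ] HBC))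
  σAB : HTensor HA HBA →L[ℂ] HTensor HA HBA
  σBC : HTensor HBC HC →L[ℂ] HTensor HBC HC
  densityAB : IsDensityOperator σAB
  densityBC : IsDensityOperator σBC
  prob : ∀ i j k x y z,
    HasTrace (opTensor σAB σBC * opTensorMiddle (A x i) (B y j) (C z k)) (p i j k x y z : ℂ)

attribute [instance] TensorModel.normHA TensorModel.innerHA TensorModel.completeHA
  TensorModel.normHBA TensorModel.innerHBA TensorModel.completeHBA
  TensorModel.normHBC TensorModel.innerHBC TensorModel.completeHBC
  TensorModel.normHC TensorModel.innerHC TensorModel.completeHC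

/-- A realization of `p(αβγ|xyz)` in the commuting observables model. -/
structure CommutingModel {X Y Z α β γ : Type v} [Fintype α] [Fintype β] [Fintype γ]
    (p : α → β → γ → X → Y → Z → ℝ) where
  D : Type u
  [cstarD : CStarAlgebra D]
  𝒜 : StarSubalgebra ℂ D
  ℬA : StarSubalgebra ℂ D
  ℬC : StarSubalgebra ℂ D
  𝒞 : StarSubalgebra ℂ D
  closedA : IsClosed (𝒜 : Set D)
  closedBA : IsClosed (ℬA : Set D)
  closedBC : IsClosed (ℬC : Set D)
  closedC : IsClosed (𝒞 : Set D)
  comm_A_BA : MutuallyCommute (𝒜 : Set D) (ℬA : Set D)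
  comm_A_BC : MutuallyCommute (𝒜 : Set D) (ℬC : Set D)
  comm_A_C : MutuallyCommute (𝒜 : Set D) (𝒞 : Set D)
  comm_BA_BC : MutuallyCommute (ℬA : Set D) (ℬC : Set D)
  comm_BA_C : MutuallyCommute (ℬA : Set D) (𝒞 : Set D)
  comm_BC_C : MutuallyCommute (ℬC : Set D) (𝒞 : Set D)
  A : X → α → D
  B : Y → β → D
  C : Z → γ → D
  povmA : ∀ x, IsPOVM (A x)
  povmB : ∀ y, IsPOVM (B y)
  povmC : ∀ z, IsPOVM (C z)
  A_mem : ∀ x i, A x i ∈ 𝒜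
  B_mem : ∀ y j, B y j ∈ generatedCStar ((ℬA : Set D) ∪ (ℬC : Set D))
  C_mem : ∀ z k, C z k ∈ 𝒞
  ρ : D →ₗ[ℂ] ℂ
  state : IsState ρ
  factor : ∀ a ∈ 𝒜, ∀ bA ∈ ℬA, ∀ bC ∈ ℬC, ∀ c ∈ 𝒞,
    ρ (a * bA * bC * c) = ρ (a * bA) * ρ (bC * c)
  prob : ∀ i j k x y z, (p i j k x y z : ℂ) = ρ (A x i * B y j * C z k)

attribute [instance] CommutingModel.cstarD

/-- A realization of `p(αβγ|xyz)` in the reduced model. -/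
structure ReducedModel {X Y Z α β γ : Type v} [Fintype α] [Fintype β] [Fintype γ]
    (p : α → β → γ → X → Y → Z → ℝ) where
  D : Type u
  [cstarD : CStarAlgebra D]
  𝒜 : StarSubalgebra ℂ D
  ℬ : StarSubalgebra ℂ D
  𝒞 : StarSubalgebra ℂ D
  closedA : IsClosed (𝒜 : Set D)
  closedB : IsClosed (ℬ : Set D)
  closedC : IsClosed (𝒞 : Set D)
  comm_A_B : MutuallyCommute (𝒜 : Set D) (ℬ : Set D)
  comm_A_C : MutuallyCommute (𝒜 : Set D) (𝒞 : Set D)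
  comm_B_C : MutuallyCommute (ℬ : Set D) (𝒞 : Set D)
  A : X → α → D
  B : Y → β → D
  C : Z → γ → D
  povmA : ∀ x, IsPOVM (A x)
  povmB : ∀ y, IsPOVM (B y)
  povmC : ∀ z, IsPOVM (C z)
  A_mem : ∀ x i, A x i ∈ 𝒜
  B_mem : ∀ y j, B y j ∈ ℬ
  C_mem : ∀ z k, C z k ∈ 𝒞
  ρ : D →ₗ[ℂ] ℂ
  state : IsState ρ
  factor : ∀ a ∈ 𝒜, ∀ c ∈ 𝒞, ρ (a * c) = ρ a * ρ c
  prob : ∀ i j k x y z, (p i j k x y z : ℂ) = ρ (A x i * B y j * C z k)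

attribute [instance] ReducedModel.cstarD

/-- A realization of `p(αβγ|xyz)` in the mixed model. -/
structure MixedModel {X Y Z α β γ : Type v} [Fintype α] [Fintype β] [Fintype γ]
    (p : α → β → γ → X → Y → Z → ℝ) where
  HAB : Type u
  HBC : Type u
  [normHAB : NormedAddCommGroup HAB]
  [innerHAB : InnerProductSpace ℂ HAB]
  [completeHAB : CompleteSpace HAB]
  [normHBC : NormedAddCommGroup HBC]
  [innerHBC : InnerProductSpace ℂ HBC]
  [completeHBC : CompleteSpace HBC]
  𝒜 : StarSubalgebra ℂ (HAB →L[ℂ] HAB)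
  ℬA : StarSubalgebra ℂ (HAB →L[ℂ] HAB)
  ℬC : StarSubalgebra ℂ (HBC →L[ℂ] HBC)
  𝒞 : StarSubalgebra ℂ (HBC →L[ℂ] HBC)
  closedA : IsClosed (𝒜 : Set (HAB →L[ℂ] HAB))
  closedBA : IsClosed (ℬA : Set (HAB →L[ℂ] HAB))
  closedBC : IsClosed (ℬC : Set (HBC →L[ℂ] HBC))
  closedC : IsClosed (𝒞 : Set (HBC →L[ℂ] HBC))
  comm_A_BA : MutuallyCommute (𝒜 : Set (HAB →L[ℂ] HAB)) (ℬA : Set (HAB →L[ℂ] HAB))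
  comm_BC_C : MutuallyCommute (ℬC : Set (HBC →L[ℂ] HBC)) (𝒞 : Set (HBC →L[ℂ] HBC))
  A : X → α → (HAB →L[ℂ] HAB)
  B : Y → β → (HTensor HAB HBC →L[ℂ] HTensor HAB HBC)
  C : Z → γ → (HBC →L[ℂ] HBC)
  povmA : ∀ x, IsPOVM (A x)
  povmB : ∀ y, IsPOVM (B y)
  povmC : ∀ z, IsPOVM (C z)
  A_mem : ∀ x i, A x i ∈ 𝒜
  B_mem : ∀ y j, B y j ∈ vonNeumannTensor ℬA ℬC
  C_mem : ∀ z k, C z k ∈ 𝒞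
  σAB : HAB →L[ℂ] HAB
  σBC : HBC →L[ℂ] HBC
  densityAB : IsDensityOperator σAB
  densityBC : IsDensityOperator σBC
  prob : ∀ i j k x y z,
    HasTrace (opTensor σAB σBC * (opTensor (A x i) 1 * B y j * opTensor 1 (C z k)))
      (p i j k x y z : ℂ)

attribute [instance] MixedModel.normHAB MixedModel.innerHAB MixedModel.completeHAB
  MixedModel.normHBC MixedModel.innerHBC MixedModel.completeHBC

/-- A realization of `p(αβγ|xyz)` in the Renou–Xu model. -/
structure RenouXuModel {X Y Z α β γ : Type v} [Fintype α] [Fintype β] [Fintype γ]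
    (p : α → β → γ → X → Y → Z → ℝ) where
  H : Type u
  [normH : NormedAddCommGroup H]
  [innerH : InnerProductSpace ℂ H]
  [completeH : CompleteSpace H]
  P : H →L[ℂ] H
  Q : H →L[ℂ] H
  projP : IsStarProjection P
  projQ : IsStarProjection Q
  comm_P_Q : Commute P Q
  rankOne_PQ : ∃ ψ : H, ‖ψ‖ = 1 ∧ P * Q = InnerProductSpace.rankOne ℂ ψ ψ
  A : X → α → (H →L[ℂ] H)
  B : Y → β → (H →L[ℂ] H)
  C : Z → γ → (H →L[ℂ] H)
  povmA : ∀ x, IsPOVM (A x)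
  povmB : ∀ y, IsPOVM (B y)
  povmC : ∀ z, IsPOVM (C z)
  comm_A_B : ∀ x i y j, Commute (A x i) (B y j)
  comm_A_C : ∀ x i z k, Commute (A x i) (C z k)
  comm_B_C : ∀ y j z k, Commute (B y j) (C z k)
  comm_A_Q : ∀ x i, Commute (A x i) Q
  comm_P_C : ∀ z k, Commute P (C z k)
  prob : ∀ i j k x y z, HasTrace (P * Q * (A x i * B y j * C z k)) (p i j k x y z : ℂ)

attribute [instance] RenouXuModel.normH RenouXuModel.innerH RenouXuModel.completeH

/-! ### Finite-dimensionality -/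

section

variable {X Y Z α β γ : Type v} [Fintype α] [Fintype β] [Fintype γ]
  {p : α → β → γ → X → Y → Z → ℝ}

/-- The `C*`-algebras generated by Alice's and by Charlie's POVMs are finite-dimensional. -/
def TensorModel.OuterFinite (M : TensorModel.{u} p) : Prop :=
  FiniteDimensional ℂ (generatedByPOVMs M.A) ∧ FiniteDimensional ℂ (generatedByPOVMs M.C)

/-- The `C*`-algebras generated by Alice's and by Charlie's POVMs are finite-dimensional. -/
def CommutingModel.OuterFinite (M : CommutingModel.{u} p) : Prop :=
  FiniteDimensional ℂ (generatedByPOVMs M.A) ∧ FiniteDimensional ℂ (generatedByPOVMs M.C)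

/-- The `C*`-algebras generated by Alice's and by Charlie's POVMs are finite-dimensional. -/
def ReducedModel.OuterFinite (M : ReducedModel.{u} p) : Prop :=
  FiniteDimensional ℂ (generatedByPOVMs M.A) ∧ FiniteDimensional ℂ (generatedByPOVMs M.C)

/-- The `C*`-algebras generated by Alice's and by Charlie's POVMs are finite-dimensional. -/
def MixedModel.OuterFinite (M : MixedModel.{u} p) : Prop :=
  FiniteDimensional ℂ (generatedByPOVMs M.A) ∧ FiniteDimensional ℂ (generatedByPOVMs M.C)

/-- The `C*`-algebras generated by Alice's and by Charlie's POVMs are finite-dimensional. -/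
def RenouXuModel.OuterFinite (M : RenouXuModel.{u} p) : Prop :=
  FiniteDimensional ℂ (generatedByPOVMs M.A) ∧ FiniteDimensional ℂ (generatedByPOVMs M.C)

/-- All Hilbert spaces of the realization (hence all operator algebras on them) are
finite-dimensional. -/
def TensorModel.IsFinite (M : TensorModel.{u} p) : Prop :=
  FiniteDimensional ℂ M.HA ∧ FiniteDimensional ℂ M.HBA ∧
    FiniteDimensional ℂ M.HBC ∧ FiniteDimensional ℂ M.HC

/-- The global algebra of the realization (hence all its subalgebras) is finite-dimensional. -/
def CommutingModel.IsFinite (M : CommutingModel.{u} p) : Prop :=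
  FiniteDimensional ℂ M.D

/-- The global algebra of the realization (hence all its subalgebras) is finite-dimensional. -/
def ReducedModel.IsFinite (M : ReducedModel.{u} p) : Prop :=
  FiniteDimensional ℂ M.D

/-- All Hilbert spaces of the realization (hence all operator algebras on them) are
finite-dimensional. -/
def MixedModel.IsFinite (M : MixedModel.{u} p) : Prop :=
  FiniteDimensional ℂ M.HAB ∧ FiniteDimensional ℂ M.HBC

/-- The Hilbert space of the realization (hence all operator algebras on it) is
finite-dimensional. -/
def RenouXuModel.IsFinite (M : RenouXuModel.{u} p) : Prop :=
  FiniteDimensional ℂ M.H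

end

end

end Bilocal

namespace Bilocal

open Matrix Kronecker

noncomputable section

/-! ### Positive functionals on star subalgebras of matrices -/

section Riesz

variable {ι : Type*} [Fintype ι] [DecidableEq ι]

/-! Each model yields a state on a C*-algebra with three commuting families of POVMs, and the state
factorizes on the algebras generated by Alice and by Charlie (`hasMatrixRealization_of_state`). The
GNS representation turns the state into a vector `Ω`. If the two outer algebras `MA`, `MC` are
finite-dimensional, so are the orbits `MA Ω` and `MC Ω`, and factorization identifies `MA MC Ω` with
their Hilbert space tensor product.

Bob's operators need not preserve this subspace, but their compressions commute with the matrix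
algebra `N` of `MA MC`. Hence `x ↦ ⟪Ω, B x Ω⟫` is a positive functional on `N`, given by a positive
density `τ` in `N`. Densities in `N` are unique, so over Bob's outcomes the `τ` sum to the density
`σ ⊗ σ'` of the product state (`hasDensityRealization_of_vector`). Bob is thereby reduced to a
decomposition of a product density matrix.

Such a decomposition is always produced by a measurement on a purification
(`exists_povm_of_sum_eq_diagonal`). In eigenbases of `σ` and `σ'` the purification is a product of
two Schmidt vectors, one shared by Alice and Bob, one by Bob and Charlie. These two
finite-dimensional pure states give all five models: the tensor and mixed models directly, the
commuting, reduced and Renou–Xu models from the mixed one. -/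

theorem eq_of_trace_mul_eq {N : StarSubalgebra ℂ (Matrix ι ι ℂ)} {s t : Matrix ι ι ℂ}
    (hs : s ∈ N) (ht : t ∈ N) (h : ∀ x ∈ N, (s * x).trace = (t * x).trace) : s = t := by
  -- This test element turns the hypothesis into the vanishing of the Hilbert–Schmidt norm of `s -
  -- t`.
  have h1 := h (star (s - t)) (star_mem (sub_mem hs ht))
  rw [← sub_eq_zero, ← trace_sub, ← sub_mul, star_eq_conjTranspose,
    trace_mul_conjTranspose_self_eq_zero_iff] at h1
  exact sub_eq_zero.1 h1

/-- The trace pairing is nondegenerate on the star-closed `N`, so a dimension count identifies `N`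
with its dual. -/
theorem exists_trace_mul_eq (N : StarSubalgebra ℂ (Matrix ι ι ℂ)) (f : Matrix ι ι ℂ →ₗ[ℂ] ℂ) :
    ∃ t ∈ N, ∀ x ∈ N, (t * x).trace = f x := by
  let W : Submodule ℂ (Matrix ι ι ℂ) := N.toSubalgebra.toSubmodule
  let Φ : W →ₗ[ℂ] Module.Dual ℂ W :=
    ((LinearMap.mul ℂ (Matrix ι ι ℂ)).compr₂ (traceLinearMap ι ℂ ℂ)).domRestrict₁₂ W W
  have hΦ (s x : W) : Φ s x = ((s : Matrix ι ι ℂ) * x).trace := rfl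
  have hinj : Function.Injective Φ := by
    intro s t hst
    refine Subtype.ext (eq_of_trace_mul_eq (N := N) s.2 t.2 fun x hx ↦ ?_)
    exact congrArg (fun g : Module.Dual ℂ W ↦ g ⟨x, hx⟩) hst
  have hsurj : Function.Surjective Φ :=
    (LinearMap.injective_iff_surjective_of_finrank_eq_finrank
      (Subspace.dual_finrank_eq (K := ℂ) (V := W)).symm).1 hinj
  obtain ⟨t, ht⟩ := hsurj (f ∘ₗ W.subtype)
  refine ⟨t, t.2, fun x hx ↦ ?_⟩
  exact congrArg (fun g : Module.Dual ℂ W ↦ g ⟨x, hx⟩) ht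

/-- Positivity is only known against elements of `N`, so the test element must be found there: the
square root of the negative part of `t`, written as a polynomial in `t`. The trace then becomes a
sum of nonpositive terms, one for each eigenvalue, and its nonnegativity excludes negative
eigenvalues. -/
theorem posSemidef_of_trace_mul_nonneg {N : StarSubalgebra ℂ (Matrix ι ι ℂ)} {t : Matrix ι ι ℂ}
    (ht : t ∈ N) (hH : t.IsHermitian) (h : ∀ y ∈ N, 0 ≤ (t * (star y * y)).trace) :
    t.PosSemidef := by
  rw [hH.posSemidef_iff_eigenvalues_nonneg]
  set e := hH.eigenvalues with he
  let g : ℂ → ℂ := fun z ↦ (Real.sqrt (max (-z.re) 0) : ℂ)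
  let S : Finset ℂ := Finset.univ.image fun i ↦ (e i : ℂ)
  -- Only the finitely many eigenvalues matter, so interpolation replaces the continuous functional
  -- calculus.
  let q : Polynomial ℂ := Lagrange.interpolate S id g
  have hq (i : ι) : q.eval (e i : ℂ) = Real.sqrt (max (-e i) 0) := by
    have := Lagrange.eval_interpolate_at_node (s := S) (v := id) (i := (e i : ℂ)) g
      (fun a _ b _ h ↦ h) (Finset.mem_image_of_mem _ (Finset.mem_univ i))
    rw [show q = Lagrange.interpolate S id g from rfl]
    simpa only [id, g, Complex.ofReal_re] using this
  let U := hH.eigenvectorUnitary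
  have hspec : t = Unitary.conjStarAlgAut ℂ _ U (diagonal (RCLike.ofReal ∘ e)) :=
    hH.spectral_theorem
  let y := Polynomial.aeval t q
  have hyN : y ∈ N := (Algebra.adjoin_le (S := N.toSubalgebra) (by simpa using ht))
    (Polynomial.aeval_mem_adjoin_singleton ℂ t)
  have hdiag : Polynomial.aeval (diagonal (RCLike.ofReal ∘ e) : Matrix ι ι ℂ) q =
      diagonal fun i ↦ (Real.sqrt (max (-e i) 0) : ℂ) := by
    have := Polynomial.aeval_algHom_apply (diagonalAlgHom ℂ : (ι → ℂ) →ₐ[ℂ] Matrix ι ι ℂ)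
      (RCLike.ofReal ∘ e) q
    simp only [diagonalAlgHom_apply] at this
    rw [this]
    congr 1
    ext i
    rw [← hq i, Polynomial.aeval_pi_apply]
    simp
  have hy : y = Unitary.conjStarAlgAut ℂ _ U (diagonal fun i ↦ (Real.sqrt (max (-e i) 0) : ℂ)) := by
    rw [← hdiag]
    conv_lhs => simp only [y]; rw [hspec]
    exact Polynomial.aeval_algHom_apply
      (Unitary.conjStarAlgAut ℂ (Matrix ι ι ℂ) U).toAlgEquiv.toAlgHom _ q
  have hpos := h y hyN
  have hprod : t * (star y * y) = Unitary.conjStarAlgAut ℂ _ U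
      (diagonal fun i ↦ ((e i * max (-e i) 0 : ℝ) : ℂ)) := by
    rw [hy, ← map_star, ← map_mul]
    conv_lhs => rw [hspec]
    rw [← map_mul, star_eq_conjTranspose, diagonal_conjTranspose, diagonal_mul_diagonal,
      diagonal_mul_diagonal]
    congr 2
    ext i
    have : Real.sqrt (max (-e i) 0) * Real.sqrt (max (-e i) 0) = max (-e i) 0 :=
      Real.mul_self_sqrt (le_max_right _ _)
    simp [← Complex.ofReal_mul, this]
  rw [hprod, Unitary.conjStarAlgAut_apply, trace_mul_comm, ← mul_assoc, Unitary.coe_star_mul_self,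
    one_mul, trace_diagonal, ← Complex.ofReal_sum, Complex.zero_le_real] at hpos
  have hnp (i : ι) : e i * max (-e i) 0 ≤ 0 := by
    rcases le_total 0 (e i) with h0 | h0
    · rw [max_eq_right (by linarith)]; simp
    · exact mul_nonpos_of_nonpos_of_nonneg h0 (le_max_right _ _)
  have hzero := (Finset.sum_eq_zero_iff_of_nonpos fun i _ ↦ hnp i).1
    (le_antisymm (Finset.sum_nonpos fun i _ ↦ hnp i) hpos)
  intro i
  by_contra! hneg
  have hneg : e i < 0 := hneg
  have := hzero i (Finset.mem_univ i)
  rw [max_eq_left (by linarith)] at this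
  nlinarith

theorem exists_density {N : StarSubalgebra ℂ (Matrix ι ι ℂ)} {f : Matrix ι ι ℂ →ₗ[ℂ] ℂ}
    (hstar : ∀ x ∈ N, f (star x) = star (f x)) (hpos : ∀ y ∈ N, 0 ≤ f (star y * y)) :
    ∃ t ∈ N, t.PosSemidef ∧ ∀ x ∈ N, (t * x).trace = f x := by
  obtain ⟨t, ht, htf⟩ := exists_trace_mul_eq N f
  refine ⟨t, ht, posSemidef_of_trace_mul_nonneg ht ?_ fun y hy ↦ ?_, htf⟩
  -- Since `f` is hermitian on `N`, `star t` represents the same functional as `t`; uniqueness makes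
  -- `t` hermitian.
  · refine eq_of_trace_mul_eq (N := N) (star_mem ht) ht fun x hx ↦ ?_
    rw [htf x hx, ← star_star x, hstar _ (star_mem hx), ← htf _ (star_mem hx),
      star_eq_conjTranspose, star_eq_conjTranspose, ← trace_conjTranspose, conjTranspose_mul,
      conjTranspose_conjTranspose, ← star_eq_conjTranspose, star_eq_conjTranspose, trace_mul_comm]
  · rw [htf _ (mul_mem (star_mem hy) hy)]
    exact hpos y hy

end Riesz

/-- The span of a multiplicatively closed self-adjoint set containing the unit. -/
def spanStarSubalgebra {R : Type*} [Ring R] [Algebra ℂ R] [StarRing R] [StarModule ℂ R] (S : Set R)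
    (hone : (1 : R) ∈ S) (hmul : ∀ x ∈ S, ∀ y ∈ S, x * y ∈ S) (hstar : ∀ x ∈ S, star x ∈ S) :
    StarSubalgebra ℂ R where
  carrier := Submodule.span ℂ S
  mul_mem' {x y} hx hy := by
    have h := Submodule.mul_mem_mul hx hy
    rw [Submodule.span_mul_span] at h
    refine Submodule.span_mono ?_ h
    rintro _ ⟨a, ha, b, hb, rfl⟩
    exact hmul a ha b hb
  add_mem' hx hy := add_mem hx hy
  algebraMap_mem' r := by
    rw [Algebra.algebraMap_eq_smul_one]
    exact Submodule.smul_mem _ _ (Submodule.subset_span hone)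
  star_mem' {x} hx := by
    induction hx using Submodule.span_induction with
    | mem x hx => exact Submodule.subset_span (hstar x hx)
    | zero => simp
    | add x y _ _ hx hy => rw [star_add]; exact add_mem hx hy
    | smul r x _ hx => rw [star_smul]; exact Submodule.smul_mem _ _ hx

/-! ### Compressions of operators to finite families of vectors -/

section Compress

variable {H : Type u} [NormedAddCommGroup H] [InnerProductSpace ℂ H] {ι : Type*}

/-- The matrix of the coefficients `⟪v i, T (v j)⟫`. -/
def compress (v : ι → H) : (H →L[ℂ] H) →ₗ[ℂ] Matrix ι ι ℂ where
  toFun T := Matrix.of fun i j ↦ inner ℂ (v i) (T (v j))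
  map_add' S T := by ext i j; simp
  map_smul' c T := by ext i j; simp

theorem compress_apply (v : ι → H) (T : H →L[ℂ] H) (i j : ι) :
    compress v T i j = inner ℂ (v i) (T (v j)) := rfl

theorem compress_one [DecidableEq ι] {v : ι → H} (hv : Orthonormal ℂ v) : compress v 1 = 1 := by
  ext i j
  rw [compress_apply, one_apply_eq_self, orthonormal_iff_ite.1 hv, Matrix.one_apply]

theorem compress_star [CompleteSpace H] (v : ι → H) (T : H →L[ℂ] H) :
    compress v (star T) = star (compress v T) := by
  ext i j
  rw [star_eq_conjTranspose, conjTranspose_apply, compress_apply, compress_apply,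
    ContinuousLinearMap.star_eq_adjoint, ContinuousLinearMap.adjoint_inner_right]
  exact (inner_conj_symm _ _).symm

/-- Multiplicativity requires only the right factor to leave the span invariant. The left factor is
arbitrary, which allows Bob's operators there. -/
theorem compress_mul [Fintype ι] (v : ι → H) (S : H →L[ℂ] H) {T : H →L[ℂ] H}
    (hT : ∀ j, T (v j) = ∑ i, compress v T i j • v i) :
    compress v (S * T) = compress v S * compress v T := by
  ext i j
  rw [compress_apply, mul_apply_eq_comp, hT, Matrix.mul_apply, map_sum, inner_sum]
  refine Finset.sum_congr rfl fun k _ ↦ ?_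
  rw [map_smul, inner_smul_right, compress_apply v S, mul_comm]

theorem posSemidef_compress [Finite ι] [CompleteSpace H] (v : ι → H) {T : H →L[ℂ] H}
    (hT : ∃ b, T = star b * b) : (compress v T).PosSemidef := by
  obtain ⟨b, rfl⟩ := hT
  have : Fintype ι := Fintype.ofFinite ι
  refine PosSemidef.of_dotProduct_mulVec_nonneg ?_ fun x ↦ ?_
  · rw [IsHermitian, ← star_eq_conjTranspose, ← compress_star, star_mul, star_star]
  · have : star x ⬝ᵥ (compress v (star b * b) *ᵥ x) =
        inner ℂ (b (∑ i, x i • v i)) (b (∑ i, x i • v i)) := by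
      simp only [dotProduct, mulVec, compress_apply, map_sum, map_smul, inner_sum, sum_inner,
        inner_smul_left, inner_smul_right, Finset.mul_sum, Pi.star_apply,
        mul_apply_eq_comp, ContinuousLinearMap.star_eq_adjoint,
        ContinuousLinearMap.adjoint_inner_right]
      rw [Finset.sum_comm]
      refine Finset.sum_congr rfl fun i _ ↦ Finset.sum_congr rfl fun j _ ↦ ?_
      simp only [RCLike.star_def]
      ring
    rw [this, inner_self_eq_norm_sq_to_K]
    norm_cast
    positivity

theorem inner_apply_eq_dotProduct_compress [Fintype ι] {v : ι → H} {Ω : H} {w : ι → ℂ}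
    (hΩ : Ω = ∑ i, w i • v i) (T : H →L[ℂ] H) :
    inner ℂ Ω (T Ω) = star w ⬝ᵥ (compress v T *ᵥ w) := by
  subst hΩ
  simp only [dotProduct, mulVec, compress_apply, map_sum, map_smul, inner_sum, sum_inner,
    inner_smul_left, inner_smul_right, Finset.mul_sum, Pi.star_apply]
  rw [Finset.sum_comm]
  refine Finset.sum_congr rfl fun i _ ↦ Finset.sum_congr rfl fun j _ ↦ ?_
  simp only [RCLike.star_def]
  ring

/-- The basis vectors of the orbit are kept in the form `a i Ω` with `a i ∈ M`, so that commutation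
and factorization can later be applied to the `a i`. -/
theorem exists_orthonormal_orbit [CompleteSpace H] (M : StarSubalgebra ℂ (H →L[ℂ] H))
    [FiniteDimensional ℂ M] (Ω : H) :
    ∃ (m : ℕ) (a : Fin m → (H →L[ℂ] H)), (∀ i, a i ∈ M) ∧ Orthonormal ℂ (fun i ↦ a i Ω) ∧
      ∀ b ∈ M, b Ω = ∑ i, (inner ℂ (a i Ω) (b Ω) : ℂ) • a i Ω := by
  let ev : M →ₗ[ℂ] H :=
    { toFun b := (b : H →L[ℂ] H) Ω
      map_add' _ _ := rfl
      map_smul' _ _ := rfl }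
  let K := LinearMap.range ev
  have : FiniteDimensional ℂ K := LinearMap.finiteDimensional_range ev
  let e := stdOrthonormalBasis ℂ K
  choose a ha using fun i ↦ (e i).2
  refine ⟨_, fun i ↦ a i, fun i ↦ (a i).2, ?_, fun b hb ↦ ?_⟩
  · have h := e.orthonormal.comp_linearIsometry K.subtypeₗᵢ
    convert h using 2 with i
    exact ha i
  · have h := congrArg (fun x : K ↦ (x : H)) (e.sum_repr ⟨b Ω, ⟨b, hb⟩, rfl⟩)
    simp only [Submodule.coe_sum, Submodule.coe_smul, e.repr_apply_apply, Submodule.coe_inner] at h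
    refine h.symm.trans (Finset.sum_congr rfl fun i _ ↦ ?_)
    rw [show ((a i : H →L[ℂ] H) Ω) = e i from ha i]

end Compress

/-- Because `T` commutes with `N`, the functional takes `star y * y` to the quadratic form of `T` at
`y w`, which is nonnegative. With `T = 1` this gives the density of a vector state, with Bob's
compressed operators the unnormalized states conditioned on his outcomes. -/
theorem exists_density_of_commute {ι : Type*} [Fintype ι] [DecidableEq ι]
    {N : StarSubalgebra ℂ (Matrix ι ι ℂ)} {T : Matrix ι ι ℂ} (hT : T.PosSemidef)
    (hTN : ∀ x ∈ N, Commute T x) (w : ι → ℂ) :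
    ∃ t ∈ N, t.PosSemidef ∧ ∀ x ∈ N, (t * x).trace = star w ⬝ᵥ ((T * x) *ᵥ w) := by
  let f : Matrix ι ι ℂ →ₗ[ℂ] ℂ :=
    { toFun x := star w ⬝ᵥ ((T * x) *ᵥ w)
      map_add' x y := by rw [mul_add, add_mulVec, dotProduct_add]
      map_smul' c x := by rw [mul_smul_comm, smul_mulVec, dotProduct_smul]; rfl }
  refine exists_density (f := f) (fun x hx ↦ ?_) fun y hy ↦ ?_
  · change star w ⬝ᵥ ((T * star x) *ᵥ w) = star (star w ⬝ᵥ ((T * x) *ᵥ w))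
    rw [← star_dotProduct, star_mulVec, ← dotProduct_mulVec, conjTranspose_mul, hT.1.eq,
      (hTN _ (star_mem hx)).eq, star_eq_conjTranspose]
  · change 0 ≤ star w ⬝ᵥ ((T * (star y * y)) *ᵥ w)
    have h := hT.dotProduct_mulVec_nonneg (y *ᵥ w)
    rwa [star_mulVec, mulVec_mulVec, ← dotProduct_mulVec, mulVec_mulVec, ← mul_assoc,
      ← star_eq_conjTranspose, ← (hTN _ (star_mem hy)).eq, mul_assoc] at h

/-- Correlations of the form `tr (τ (A ⊗ C))`, where the `τ` are positive matrices which sum to a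
product of density matrices. -/
def HasDensityRealization {X Y Z α β γ : Type v} [Fintype α] [Fintype β] [Fintype γ]
    (p : α → β → γ → X → Y → Z → ℝ) : Prop :=
  ∃ (m n : ℕ) (A : X → α → Matrix (Fin m) (Fin m) ℂ) (C : Z → γ → Matrix (Fin n) (Fin n) ℂ)
    (τ : Y → β → Matrix (Fin m × Fin n) (Fin m × Fin n) ℂ)
    (σ : Matrix (Fin m) (Fin m) ℂ) (σ' : Matrix (Fin n) (Fin n) ℂ),
    (∀ x i, (A x i).PosSemidef) ∧ (∀ x, ∑ i, A x i = 1) ∧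
    (∀ z k, (C z k).PosSemidef) ∧ (∀ z, ∑ k, C z k = 1) ∧
    (∀ y j, (τ y j).PosSemidef) ∧ (∀ y, ∑ j, τ y j = σ ⊗ₖ σ') ∧
    σ.PosSemidef ∧ σ.trace = 1 ∧ σ'.PosSemidef ∧ σ'.trace = 1 ∧
    ∀ i j k x y z, (p i j k x y z : ℂ) = (τ y j * (A x i ⊗ₖ C z k)).trace

/-! ### From a factorizing vector state to finite density matrices. -/

section VectorState

variable {H : Type u} [NormedAddCommGroup H] [InnerProductSpace ℂ H] [CompleteSpace H]

theorem inner_star_left (S : H →L[ℂ] H) (x y : H) : inner ℂ (S x) y = inner ℂ x (star S y) := by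
  rw [ContinuousLinearMap.star_eq_adjoint, ContinuousLinearMap.adjoint_inner_right]

theorem hasDensityRealization_of_vector {X Y Z α β γ : Type v} [Fintype α] [Fintype β] [Fintype γ]
    {p : α → β → γ → X → Y → Z → ℝ} (MA MC : StarSubalgebra ℂ (H →L[ℂ] H))
    [FiniteDimensional ℂ MA] [FiniteDimensional ℂ MC]
    (hAC : ∀ a ∈ MA, ∀ c ∈ MC, Commute a c) {Ω : H} (hΩ : ‖Ω‖ = 1)
    (hfac : ∀ a ∈ MA, ∀ c ∈ MC,
      (inner ℂ Ω ((a * c) Ω) : ℂ) = inner ℂ Ω (a Ω) * inner ℂ Ω (c Ω))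
    {A : X → α → (H →L[ℂ] H)} {B : Y → β → (H →L[ℂ] H)} {C : Z → γ → (H →L[ℂ] H)}
    (hA : ∀ x i, A x i ∈ MA) (hC : ∀ z k, C z k ∈ MC)
    (povmA : ∀ x, IsPOVM (A x)) (povmB : ∀ y, IsPOVM (B y)) (povmC : ∀ z, IsPOVM (C z))
    (hBA : ∀ y j, ∀ a ∈ MA, Commute (B y j) a) (hBC : ∀ y j, ∀ c ∈ MC, Commute (B y j) c)
    (hp : ∀ i j k x y z, (p i j k x y z : ℂ) = inner ℂ Ω ((A x i * B y j * C z k) Ω)) :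
    HasDensityRealization p := by
  obtain ⟨m, a, ha, hao, haspan⟩ := exists_orthonormal_orbit MA Ω
  obtain ⟨n, c, hc, hco, hcspan⟩ := exists_orthonormal_orbit MC Ω
  set e : Fin m → H := fun i ↦ a i Ω with he
  set f : Fin n → H := fun i ↦ c i Ω with hf
  let v : Fin m × Fin n → H := fun q ↦ (a q.1 * c q.2) Ω
  have happ (S T : H →L[ℂ] H) (x : H) : (S * T) x = S (T x) := rfl
  have heinv (x) (hx : x ∈ MA) (j) : x (e j) = ∑ i, compress e x i j • e i :=
    haspan _ (mul_mem hx (ha j))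
  have hfinv (x) (hx : x ∈ MC) (j) : x (f j) = ∑ i, compress f x i j • f i :=
    hcspan _ (mul_mem hx (hc j))
  -- Commutation collects the coefficient into `⟪Ω, (star (a i) x a j) (star (c k) z c l) Ω⟫`, which
  -- the factorization hypothesis splits.
  have hkron (x) (hx : x ∈ MA) (z) (hz : z ∈ MC) :
      compress v (x * z) = compress e x ⊗ₖ compress f z := by
    ext ⟨i, k⟩ ⟨j, l⟩
    have h1 : (a i * c k) = c k * a i := (hAC _ (ha i) _ (hc k)).eq
    rw [kroneckerMap_apply, compress_apply, compress_apply, compress_apply]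
    simp only [v, he, hf]
    rw [inner_star_left, inner_star_left, inner_star_left, ← happ x, ← happ z, ← happ (x * z),
      ← happ, ← happ, ← happ, ← hfac _ (mul_mem (star_mem (ha i)) (mul_mem hx (ha j)))
        _ (mul_mem (star_mem (hc k)) (mul_mem hz (hc l)))]
    congr 2
    rw [h1, star_mul]
    have h2 : z * a j = a j * z := (hAC _ (ha j) _ hz).eq.symm
    have h3 : star (c k) * (x * a j) = x * a j * star (c k) :=
      (hAC _ (mul_mem hx (ha j)) _ (star_mem (hc k))).eq.symm
    calc star (a i) * star (c k) * (x * z * (a j * c l))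
        = star (a i) * (star (c k) * (x * (z * a j) * c l)) := by simp only [mul_assoc]
      _ = star (a i) * (star (c k) * (x * a j) * (z * c l)) := by rw [h2]; simp only [mul_assoc]
      _ = _ := by rw [h3]; simp only [mul_assoc]
  have hvinv (x) (hx : x ∈ MA) (z) (hz : z ∈ MC) (q) :
      (x * z) (v q) = ∑ r, compress v (x * z) r q • v r := by
    obtain ⟨j, l⟩ := q
    have h1 : (x * z) * (a j * c l) = (x * a j) * (z * c l) := by
      have h2 : z * a j = a j * z := (hAC _ (ha j) _ hz).eq.symm
      rw [mul_assoc, ← mul_assoc z, h2]; simp only [mul_assoc]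
    have h3 (k : Fin n) : (x * a j) (f k) = ∑ i, compress e x i j • v (i, k) := by
      change (x * a j * c k) Ω = _
      rw [(hAC _ (mul_mem hx (ha j)) _ (hc k)).eq, happ]
      change c k (x (e j)) = _
      rw [heinv x hx, map_sum]
      refine Finset.sum_congr rfl fun i _ ↦ ?_
      rw [map_smul]
      congr 1
      change (c k * a i) Ω = (a i * c k) Ω
      rw [(hAC _ (ha i) _ (hc k)).eq]
    change ((x * z) * (a j * c l)) Ω = _
    rw [h1, happ]
    change (x * a j) (z (f l)) = _
    rw [hfinv z hz, map_sum, hkron x hx z hz, Fintype.sum_prod_type_right]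
    refine Finset.sum_congr rfl fun k _ ↦ ?_
    rw [map_smul, h3, Finset.smul_sum]
    refine Finset.sum_congr rfl fun i _ ↦ ?_
    rw [smul_smul, kroneckerMap_apply, mul_comm]
  -- The Gram matrix of `v` is the Kronecker formula at `x = z = 1`.
  have hvo : Orthonormal ℂ v := by
    rw [orthonormal_iff_ite]
    have h := hkron 1 (one_mem _) 1 (one_mem _)
    rw [compress_one hao, compress_one hco, one_kronecker_one, one_mul] at h
    intro q r
    exact (congrFun₂ h q r).trans (Matrix.one_apply)
  set wA : Fin m → ℂ := fun i ↦ inner ℂ (e i) Ω with hwA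
  set wC : Fin n → ℂ := fun i ↦ inner ℂ (f i) Ω with hwC
  let w : Fin m × Fin n → ℂ := fun q ↦ wA q.1 * wC q.2
  have hΩA : Ω = ∑ i, wA i • e i := haspan 1 (one_mem _)
  have hΩC : Ω = ∑ i, wC i • f i := hcspan 1 (one_mem _)
  have hΩv : Ω = ∑ q, w q • v q := by
    rw [Fintype.sum_prod_type_right]
    conv_lhs => rw [hΩC]
    refine Finset.sum_congr rfl fun k _ ↦ ?_
    have : f k = ∑ i, wA i • v (i, k) := by
      change c k Ω = _
      conv_lhs => rw [hΩA]
      rw [map_sum]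
      refine Finset.sum_congr rfl fun i _ ↦ ?_
      rw [map_smul]
      congr 1
      change (c k * a i) Ω = (a i * c k) Ω
      rw [(hAC _ (ha i) _ (hc k)).eq]
    rw [this, Finset.smul_sum]
    refine Finset.sum_congr rfl fun i _ ↦ ?_
    rw [smul_smul, mul_comm]
  let NA : StarSubalgebra ℂ (Matrix (Fin m) (Fin m) ℂ) :=
    spanStarSubalgebra (compress e '' MA) ⟨1, one_mem _, compress_one hao⟩
      (by
        rintro _ ⟨x, hx, rfl⟩ _ ⟨y, hy, rfl⟩
        exact ⟨x * y, mul_mem hx hy, compress_mul _ _ (heinv y hy)⟩)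
      (by rintro _ ⟨x, hx, rfl⟩; exact ⟨star x, star_mem hx, compress_star _ _⟩)
  let NC : StarSubalgebra ℂ (Matrix (Fin n) (Fin n) ℂ) :=
    spanStarSubalgebra (compress f '' MC) ⟨1, one_mem _, compress_one hco⟩
      (by
        rintro _ ⟨x, hx, rfl⟩ _ ⟨y, hy, rfl⟩
        exact ⟨x * y, mul_mem hx hy, compress_mul _ _ (hfinv y hy)⟩)
      (by rintro _ ⟨x, hx, rfl⟩; exact ⟨star x, star_mem hx, compress_star _ _⟩)
  let S : Set (Matrix (Fin m × Fin n) (Fin m × Fin n) ℂ) :=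
    Set.image2 (fun x z ↦ compress e x ⊗ₖ compress f z) MA MC
  let N : StarSubalgebra ℂ (Matrix (Fin m × Fin n) (Fin m × Fin n) ℂ) :=
    spanStarSubalgebra S
      ⟨1, one_mem _, 1, one_mem _, by dsimp only; rw [compress_one hao, compress_one hco, one_kronecker_one]⟩
      (by
        rintro _ ⟨x, hx, z, hz, rfl⟩ _ ⟨x', hx', z', hz', rfl⟩
        refine ⟨x * x', mul_mem hx hx', z * z', mul_mem hz hz', ?_⟩
        simp only [compress_mul _ _ (heinv x' hx'), compress_mul _ _ (hfinv z' hz'),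
          mul_kronecker_mul])
      (by
        rintro _ ⟨x, hx, z, hz, rfl⟩
        refine ⟨star x, star_mem hx, star z, star_mem hz, ?_⟩
        simp only [compress_star, star_eq_conjTranspose, conjTranspose_kronecker])
  -- This places `σ ⊗ₖ σ'` in `N`, as the uniqueness of densities requires.
  have hNkron (x) (hx : x ∈ NA) (z) (hz : z ∈ NC) : x ⊗ₖ z ∈ N := by
    change x ⊗ₖ z ∈ Submodule.span ℂ S
    induction hx, hz using Submodule.span_induction₂ with
    | mem_mem x z hx hz =>
      obtain ⟨x, hx, rfl⟩ := hx
      obtain ⟨z, hz, rfl⟩ := hz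
      exact Submodule.subset_span ⟨x, hx, z, hz, rfl⟩
    | zero_left => simp
    | zero_right => simp
    | add_left x y z _ _ _ h h' => rw [add_kronecker]; exact add_mem h h'
    | add_right x y z _ _ _ h h' => rw [kronecker_add]; exact add_mem h h'
    | smul_left r x y _ _ h => rw [smul_kronecker]; exact Submodule.smul_mem _ _ h
    | smul_right r x y _ _ h => rw [kronecker_smul]; exact Submodule.smul_mem _ _ h
  have hcommT (y j) : ∀ x ∈ N, Commute (compress v (B y j)) x := by
    intro x hx
    induction hx using Submodule.span_induction with
    | mem x hx =>
      obtain ⟨x, hx, z, hz, rfl⟩ := hx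
      have hBsa : star (B y j) = B y j := by
        obtain ⟨b, hb⟩ := (povmB y).1 j
        rw [hb, star_mul, star_star]
      have hcx (x) (hx : x ∈ MA) (z) (hz : z ∈ MC) : compress v (B y j * (x * z)) =
          compress v (B y j) * compress v (x * z) := compress_mul _ _ (hvinv x hx z hz)
      simp only [← hkron x hx z hz]
      rw [commute_iff_eq, ← hcx x hx z hz]
      -- The span of `v` need not be invariant under `B y j`, so products are compressed directly
      -- only with `B y j` on the left. Adjoints reduce the other order to this one.
      apply star_injective
      rw [star_mul, ← compress_star, ← compress_star, ← compress_star, hBsa, star_mul, star_mul,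
        hBsa, ← (hAC _ (star_mem hx) _ (star_mem hz)).eq, ← hcx _ (star_mem hx) _ (star_mem hz),
        ← ((hBA y j _ (star_mem hx)).mul_right (hBC y j _ (star_mem hz))).eq]
    | zero => exact Commute.zero_right _
    | add x y _ _ hx hy => exact hx.add_right hy
    | smul r x _ hx => exact hx.smul_right r
  have hτ (y j) := exists_density_of_commute (N := N)
    (posSemidef_compress v ((povmB y).1 j)) (hcommT y j) w
  choose τ hτN hτpos hτtr using hτ
  obtain ⟨σ, hσN, hσpos, hσtr⟩ := exists_density_of_commute (N := NA) PosSemidef.one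
    (fun x _ ↦ Commute.one_left x) wA
  obtain ⟨σ', hσN', hσpos', hσtr'⟩ := exists_density_of_commute (N := NC) PosSemidef.one
    (fun x _ ↦ Commute.one_left x) wC
  have hσx (x) (hx : x ∈ MA) : (σ * compress e x).trace = inner ℂ Ω (x Ω) := by
    rw [hσtr _ (Submodule.subset_span ⟨x, hx, rfl⟩), one_mul,
      ← inner_apply_eq_dotProduct_compress hΩA]
  have hσx' (x) (hx : x ∈ MC) : (σ' * compress f x).trace = inner ℂ Ω (x Ω) := by
    rw [hσtr' _ (Submodule.subset_span ⟨x, hx, rfl⟩), one_mul,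
      ← inner_apply_eq_dotProduct_compress hΩC]
  have hτx (y j) (x) (hx : x ∈ MA) (z) (hz : z ∈ MC) :
      (τ y j * (compress e x ⊗ₖ compress f z)).trace = inner ℂ Ω ((B y j * (x * z)) Ω) := by
    have hmem : compress e x ⊗ₖ compress f z ∈ N := Submodule.subset_span ⟨x, hx, z, hz, rfl⟩
    rw [hτtr y j _ hmem, ← hkron x hx z hz,
      ← compress_mul _ _ (hvinv x hx z hz), ← inner_apply_eq_dotProduct_compress hΩv]
  have hΩΩ : (inner ℂ Ω Ω : ℂ) = 1 := by rw [inner_self_eq_norm_sq_to_K, hΩ]; simp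
  refine ⟨m, n, fun x i ↦ compress e (A x i), fun z k ↦ compress f (C z k), τ, σ, σ',
    fun x i ↦ posSemidef_compress _ ((povmA x).1 i),
    fun x ↦ by rw [← map_sum, (povmA x).2, compress_one hao],
    fun z k ↦ posSemidef_compress _ ((povmC z).1 k),
    fun z ↦ by rw [← map_sum, (povmC z).2, compress_one hco],
    hτpos, fun y ↦ ?_, hσpos, ?_, hσpos', ?_, fun i j k x y z ↦ ?_⟩
  -- Both sides lie in `N` and represent the vector state of `Ω`: the left because Bob's operators
  -- sum to `1`, the right by factorization.
  · refine eq_of_trace_mul_eq (N := N) (sum_mem fun j _ ↦ hτN y j) (hNkron _ hσN _ hσN') ?_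
    intro x hx
    induction hx using Submodule.span_induction with
    | mem x hx =>
      obtain ⟨x, hx, z, hz, rfl⟩ := hx
      simp only [Finset.sum_mul, trace_sum, hτx y _ x hx z hz]
      rw [← inner_sum, ← _root_.sum_apply, ← Finset.sum_mul, (povmB y).2, one_mul,
        hfac x hx z hz, ← mul_kronecker_mul, trace_kronecker, hσx x hx, hσx' z hz]
    | zero => simp
    | add x y _ _ hx hy => rw [mul_add, mul_add, trace_add, trace_add, hx, hy]
    | smul r x _ hx => rw [mul_smul_comm, mul_smul_comm, trace_smul, trace_smul, hx]
  · have := hσx 1 (one_mem _)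
    rwa [compress_one hao, mul_one, one_apply_eq_self, hΩΩ] at this
  · have := hσx' 1 (one_mem _)
    rwa [compress_one hco, mul_one, one_apply_eq_self, hΩΩ] at this
  · rw [hτx y j _ (hA x i) _ (hC z k), hp, ← mul_assoc, (hBA y j _ (hA x i)).eq]

end VectorState

/-! ### From densities to measurements on a purification. -/

open scoped MatrixOrder Matrix.Norms.L2Operator in
theorem exists_eq_star_mul_self_of_posSemidef {ι : Type*} [Fintype ι] [DecidableEq ι]
    {M : Matrix ι ι ℂ} (hM : M.PosSemidef) : ∃ b, M = star b * b :=
  CStarAlgebra.nonneg_iff_eq_star_mul_self.1 hM.nonneg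

/-- A positive matrix annihilates every vector on which its quadratic form vanishes. -/
theorem apply_eq_zero_of_posSemidef {ι : Type*} [Fintype ι] [DecidableEq ι]
    {M : Matrix ι ι ℂ} (hM : M.PosSemidef) {i : ι} (hi : M i i = 0) (j : ι) :
    M i j = 0 ∧ M j i = 0 := by
  have h0 : M j i = 0 := by
    have h := (hM.dotProduct_mulVec_zero_iff (Pi.single i 1)).1 (by simp [hi])
    simpa using congrFun h j
  refine ⟨?_, h0⟩
  rw [← hM.1.apply, h0, star_zero]

/-- Correlations of the form `⟪Ψ, (A ⊗ B ⊗ C) Ψ⟫`, where `Ψ` is the product of the vectors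
`∑ r, a r • e r ⊗ e r` and `∑ s, b s • f s ⊗ f s`. -/
def HasMatrixRealization {X Y Z α β γ : Type v} [Fintype α] [Fintype β] [Fintype γ]
    (p : α → β → γ → X → Y → Z → ℝ) : Prop :=
  ∃ (m n : ℕ) (A : X → α → Matrix (Fin m) (Fin m) ℂ)
    (B : Y → β → Matrix (Fin m × Fin n) (Fin m × Fin n) ℂ)
    (C : Z → γ → Matrix (Fin n) (Fin n) ℂ) (a : Fin m → ℝ) (b : Fin n → ℝ),
    (∀ x i, (A x i).PosSemidef) ∧ (∀ x, ∑ i, A x i = 1) ∧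
    (∀ y j, (B y j).PosSemidef) ∧ (∀ y, ∑ j, B y j = 1) ∧
    (∀ z k, (C z k).PosSemidef) ∧ (∀ z, ∑ k, C z k = 1) ∧
    ∑ r, a r ^ 2 = 1 ∧ ∑ s, b s ^ 2 = 1 ∧
    ∀ i j k x y z, (p i j k x y z : ℂ) = ∑ q : Fin m × Fin n, ∑ q' : Fin m × Fin n,
      (a q.1 * b q.2 * (a q'.1 * b q'.2) : ℝ) *
        (A x i q.1 q'.1 * B y j q q' * C z k q.2 q'.2)

section

variable {X Y Z α β γ : Type v} [Fintype α] [Fintype β] [Fintype γ]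
  {p : α → β → γ → X → Y → Z → ℝ}

/-- This is the steering argument: every decomposition of a density matrix comes from a POVM on the
other half of its purification. With Schmidt vector `∑ q, g q • e q ⊗ e q` the POVM is the transpose
of `τ j`, divided on both sides by `g`. On zero weights the sum misses a projection, which is added
to one arbitrary outcome. -/
theorem exists_povm_of_sum_eq_diagonal {ι β : Type*} [Fintype ι] [DecidableEq ι] [Fintype β]
    [Nonempty β] {τ : β → Matrix ι ι ℂ} (hτ : ∀ j, (τ j).PosSemidef) {g : ι → ℝ}
    (hsum : ∑ j, τ j = diagonal fun q ↦ ((g q ^ 2 : ℝ) : ℂ)) :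
    ∃ B : β → Matrix ι ι ℂ, (∀ j, (B j).PosSemidef) ∧ (∑ j, B j = 1) ∧
      ∀ j q q', (g q * g q' : ℝ) * B j q q' = τ j q' q := by
  classical
  let j₀ : β := Classical.arbitrary β
  -- The convention `0⁻¹ = 0` makes `D` a pseudo-inverse; `E` is the projection onto the zero
  -- weights.
  let D : Matrix ι ι ℂ := diagonal fun q ↦ (((g q)⁻¹ : ℝ) : ℂ)
  let E : Matrix ι ι ℂ := diagonal fun q ↦ if g q = 0 then 1 else 0
  have hD : Dᴴ = D := by
    rw [diagonal_conjTranspose]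
    congr 1
    ext q
    simp
  -- Nonnegative diagonal entries with sum zero all vanish, and positivity then kills the whole
  -- column.
  have hzero (q : ι) (hq : g q = 0) (j : β) (q' : ι) : τ j q' q = 0 := by
    have h : ∑ j, τ j q q = 0 := by
      have := congrFun₂ hsum q q
      rwa [Matrix.sum_apply, diagonal_apply_eq, hq, zero_pow two_ne_zero, Complex.ofReal_zero]
        at this
    have h' := (Finset.sum_eq_zero_iff_of_nonneg fun j _ ↦ (hτ j).diag_nonneg (i := q)).1 h j
      (Finset.mem_univ j)
    exact (apply_eq_zero_of_posSemidef (hτ j) h' q').2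
  have hEpos : E.PosSemidef := PosSemidef.diagonal fun q ↦ by dsimp only; split_ifs <;> simp
  have hB (j : β) (q q' : ι) : (D * (τ j)ᵀ * D + if j = j₀ then E else 0) q q' =
      ((g q)⁻¹ : ℝ) * τ j q' q * ((g q')⁻¹ : ℝ) + if j = j₀ then E q q' else 0 := by
    rw [Matrix.add_apply, mul_diagonal, diagonal_mul, transpose_apply]
    split_ifs <;> rfl
  refine ⟨fun j ↦ D * (τ j)ᵀ * D + if j = j₀ then E else 0, fun j ↦ ?_, ?_, fun j q q' ↦ ?_⟩
  · refine PosSemidef.add ?_ ?_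
    · have := (hτ j).transpose.mul_mul_conjTranspose_same D
      rwa [hD] at this
    · split_ifs
      · exact hEpos
      · exact PosSemidef.zero
  · rw [Finset.sum_add_distrib, ← Finset.sum_mul, ← Finset.mul_sum, ← transpose_sum, hsum,
      diagonal_transpose, diagonal_mul_diagonal, diagonal_mul_diagonal,
      Finset.sum_ite_eq' Finset.univ j₀, if_pos (Finset.mem_univ _), diagonal_add, ← diagonal_one]
    congr 1
    ext q
    by_cases hq : g q = 0
    · simp [hq]
    · rw [if_neg hq, add_zero, ← Complex.ofReal_mul, ← Complex.ofReal_mul, ← Complex.ofReal_one]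
      congr 1
      field_simp
  · dsimp only
    rw [hB]
    by_cases hq : g q = 0
    · have h0 : τ j q' q = 0 := hzero q hq j q'
      simp [hq, h0]
    by_cases hq' : g q' = 0
    · have h0 : τ j q' q = 0 := by
        have := hzero q' hq' j q
        rw [← (hτ j).1.apply, this, star_zero]
      simp [hq', h0]
    have hE : E q q' = 0 := by
      by_cases hqq : q = q'
      · subst hqq
        simp [E, hq]
      · exact diagonal_apply_ne _ hqq
    rw [hE, ite_self, add_zero]
    have h1 : ((g q : ℝ) : ℂ) ≠ 0 := by exact_mod_cast hq
    have h2 : ((g q' : ℝ) : ℂ) ≠ 0 := by exact_mod_cast hq'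
    push_cast
    field_simp

/-- In eigenbases of `σ` and `σ'` the sum of the `τ` is diagonal, and the square roots of the
eigenvalues serve as Schmidt coefficients. -/
theorem HasDensityRealization.hasMatrixRealization (h : HasDensityRealization p) :
    HasMatrixRealization p := by
  obtain ⟨m, n, A, C, τ, σ, σ', hA, hA1, hC, hC1, hτ, hτs, hσ, hσt, hσ', hσt', hp⟩ := h
  let U : Matrix (Fin m) (Fin m) ℂ := hσ.1.eigenvectorUnitary
  let V : Matrix (Fin n) (Fin n) ℂ := hσ'.1.eigenvectorUnitary
  set s := hσ.1.eigenvalues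
  set t := hσ'.1.eigenvalues
  have hs0 : ∀ r, 0 ≤ s r := hσ.eigenvalues_nonneg
  have ht0 : ∀ r, 0 ≤ t r := hσ'.eigenvalues_nonneg
  have hUU : Uᴴ * U = 1 := Unitary.coe_star_mul_self hσ.1.eigenvectorUnitary
  have hUU' : U * Uᴴ = 1 := Unitary.coe_mul_star_self hσ.1.eigenvectorUnitary
  have hVV : Vᴴ * V = 1 := Unitary.coe_star_mul_self hσ'.1.eigenvectorUnitary
  have hVV' : V * Vᴴ = 1 := Unitary.coe_mul_star_self hσ'.1.eigenvectorUnitary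
  have hσd : Uᴴ * σ * U = diagonal fun r ↦ (s r : ℂ) := by
    have := hσ.1.conjStarAlgAut_star_eigenvectorUnitary
    rw [Unitary.conjStarAlgAut_apply, Unitary.coe_star, star_star] at this
    exact this
  have hσd' : Vᴴ * σ' * V = diagonal fun r ↦ (t r : ℂ) := by
    have := hσ'.1.conjStarAlgAut_star_eigenvectorUnitary
    rw [Unitary.conjStarAlgAut_apply, Unitary.coe_star, star_star] at this
    exact this
  have hs1 : ∑ r, s r = 1 := by
    have : (∑ r, (s r : ℂ)) = 1 := by
      rw [← hσt, ← trace_diagonal, ← hσd, trace_mul_comm, ← mul_assoc, hUU', one_mul]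
    exact_mod_cast this
  have ht1 : ∑ r, t r = 1 := by
    have : (∑ r, (t r : ℂ)) = 1 := by
      rw [← hσt', ← trace_diagonal, ← hσd', trace_mul_comm, ← mul_assoc, hVV', one_mul]
    exact_mod_cast this
  let W : Matrix (Fin m × Fin n) (Fin m × Fin n) ℂ := U ⊗ₖ V
  have hW : Wᴴ = Uᴴ ⊗ₖ Vᴴ := conjTranspose_kronecker _ _
  have hWW' : W * Wᴴ = 1 := by
    rw [hW, ← mul_kronecker_mul, hUU', hVV', one_kronecker_one]
  have hτd (y) : ∑ j, Wᴴ * τ y j * W = diagonal fun q ↦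
      (((Real.sqrt (s q.1) * Real.sqrt (t q.2)) ^ 2 : ℝ) : ℂ) := by
    rw [← Finset.sum_mul, ← Finset.mul_sum, hτs, hW, ← mul_kronecker_mul, ← mul_kronecker_mul,
      hσd, hσd', diagonal_kronecker_diagonal]
    congr 1
    ext q
    rw [mul_pow, Real.sq_sqrt (hs0 _), Real.sq_sqrt (ht0 _)]
    push_cast
    rfl
  -- Without outcomes the empty sum would force `σ ⊗ₖ σ' = 0`, against trace one.
  have hβ (y : Y) : Nonempty β := by
    by_contra hne
    rw [not_nonempty_iff] at hne
    have := congrArg trace (hτs y)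
    rw [trace_kronecker, hσt, hσt', Finset.univ_eq_empty, Finset.sum_empty, trace_zero] at this
    simp at this
  have hB (y) := have := hβ y
    exists_povm_of_sum_eq_diagonal (fun j ↦ (hτ y j).conjTranspose_mul_mul_same W) (hτd y)
  choose B hBpos hBsum hBτ using hB
  refine ⟨m, n, fun x i ↦ Uᴴ * A x i * U, B, fun z k ↦ Vᴴ * C z k * V, fun r ↦ Real.sqrt (s r),
    fun r ↦ Real.sqrt (t r), fun x i ↦ (hA x i).conjTranspose_mul_mul_same U, fun x ↦ ?_, hBpos,
    hBsum, fun z k ↦ (hC z k).conjTranspose_mul_mul_same V, fun z ↦ ?_, ?_, ?_,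
    fun i j k x y z ↦ ?_⟩
  · rw [← Finset.sum_mul, ← Finset.mul_sum, hA1, mul_one, hUU]
  · rw [← Finset.sum_mul, ← Finset.mul_sum, hC1, mul_one, hVV]
  · simp only [Real.sq_sqrt (hs0 _), hs1]
  · simp only [Real.sq_sqrt (ht0 _), ht1]
  · have h1 : (Uᴴ * A x i * U) ⊗ₖ (Vᴴ * C z k * V) = Wᴴ * (A x i ⊗ₖ C z k) * W := by
      rw [hW, ← mul_kronecker_mul, ← mul_kronecker_mul]
    have h2 : (p i j k x y z : ℂ) =
        ((Uᴴ * A x i * U) ⊗ₖ (Vᴴ * C z k * V) * (Wᴴ * τ y j * W)).trace := by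
      have h3 : Wᴴ * (A x i ⊗ₖ C z k) * W * (Wᴴ * τ y j * W) =
          Wᴴ * ((A x i ⊗ₖ C z k) * τ y j * W) := by
        calc _ = Wᴴ * (A x i ⊗ₖ C z k) * (W * Wᴴ) * (τ y j * W) := by simp only [mul_assoc]
          _ = _ := by rw [hWW', mul_one]; simp only [mul_assoc]
      rw [h1, h3, trace_mul_comm, mul_assoc, hWW', mul_one, hp, trace_mul_comm]
    rw [h2, trace]
    refine Finset.sum_congr rfl fun q _ ↦ ?_
    rw [diag_apply, Matrix.mul_apply]
    refine Finset.sum_congr rfl fun q' _ ↦ ?_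
    rw [← hBτ y j q q', kroneckerMap_apply]
    ring

/-! ### Generated C*-algebras, the GNS construction and the reduced model. -/

theorem commute_of_mem_generatedCStar {R : Type u} [CStarAlgebra R] {S T : Set R}
    (hT : ∀ t ∈ T, star t ∈ T) (h : ∀ s ∈ S, ∀ t ∈ T, Commute s t) :
    ∀ a ∈ generatedCStar S, ∀ t ∈ T, Commute a t := by
  -- The centralizer is a closed star subalgebra, so it contains the C*-algebra generated by `S`
  -- once it contains `S`.
  have hclosed : IsClosed (StarSubalgebra.centralizer ℂ T : Set R) := by
    rw [StarSubalgebra.coe_centralizer]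
    exact Set.isClosed_centralizer _
  have hle : generatedCStar S ≤ StarSubalgebra.centralizer ℂ T := by
    refine StarSubalgebra.topologicalClosure_minimal (StarAlgebra.adjoin_le fun s hs ↦ ?_) hclosed
    rw [SetLike.mem_coe, StarSubalgebra.mem_centralizer_iff]
    exact fun t ht ↦ ⟨(h s hs t ht).eq.symm, (h s hs _ (hT t ht)).eq.symm⟩
  exact fun a ha t ht ↦ ((StarSubalgebra.mem_centralizer_iff ℂ).1 (hle ha) t ht).1.symm

theorem subset_generatedCStar {R : Type u} [CStarAlgebra R] (S : Set R) :
    S ⊆ generatedCStar S :=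
  (StarAlgebra.subset_adjoin ℂ S).trans (StarSubalgebra.le_topologicalClosure _)

theorem generatedCStar_le {R : Type u} [CStarAlgebra R] {S : Set R} {M : StarSubalgebra ℂ R}
    (hM : IsClosed (M : Set R)) (h : S ⊆ M) : generatedCStar S ≤ M :=
  StarSubalgebra.topologicalClosure_minimal (StarAlgebra.adjoin_le h) hM

theorem isClosed_generatedCStar {R : Type u} [CStarAlgebra R] (S : Set R) :
    IsClosed (generatedCStar S : Set R) :=
  StarSubalgebra.isClosed_topologicalClosure _

theorem IsPOVM.star_eq {R : Type u} [CStarAlgebra R] {ι : Type v} [Fintype ι] {M : ι → R}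
    (h : IsPOVM M) (i : ι) : star (M i) = M i := by
  obtain ⟨b, hb⟩ := h.1 i
  rw [hb, star_mul, star_star]

theorem IsPOVM.map {R S : Type u} [CStarAlgebra R] [CStarAlgebra S] {ι : Type v} [Fintype ι]
    {M : ι → R} (h : IsPOVM M) (φ : R →⋆ₐ[ℂ] S) : IsPOVM fun i ↦ φ (M i) := by
  refine ⟨fun i ↦ ?_, by rw [← map_sum, h.2, map_one]⟩
  obtain ⟨b, hb⟩ := h.1 i
  exact ⟨φ b, by dsimp only; rw [hb, map_mul, map_star]⟩

theorem mem_generatedByPOVMs {R : Type u} [CStarAlgebra R] {X α : Type v} (A : X → α → R) (x : X) (i : α) :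
    A x i ∈ generatedByPOVMs A :=
  subset_generatedCStar _ ⟨x, i, rfl⟩

/-- A state on a `C*`-algebra as a positive linear map. -/
def IsState.toPositiveLinearMap {R : Type u} [CStarAlgebra R] [PartialOrder R] [StarOrderedRing R]
    {ρ : R →ₗ[ℂ] ℂ} (hρ : IsState ρ) : R →ₚ[ℂ] ℂ :=
  PositiveLinearMap.mk₀ ρ fun x hx ↦ by
    obtain ⟨b, rfl⟩ := CStarAlgebra.nonneg_iff_eq_star_mul_self.1 hx
    exact hρ.1 b

theorem IsState.exists_gns {R : Type u} [CStarAlgebra R] {ρ : R →ₗ[ℂ] ℂ} (hρ : IsState ρ) :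
    ∃ (H : Type u) (_ : NormedAddCommGroup H) (_ : InnerProductSpace ℂ H) (_ : CompleteSpace H)
      (π : R →⋆ₐ[ℂ] (H →L[ℂ] H)) (Ω : H), ‖Ω‖ = 1 ∧ ∀ a, inner ℂ Ω (π a Ω) = ρ a := by
  -- `IsState` involves no order on `R`; the spectral order is chosen only to form the GNS space.
  let _ := CStarAlgebra.spectralOrder R
  have _ := CStarAlgebra.spectralOrderedRing R
  let f := hρ.toPositiveLinearMap
  have hf (a : R) : f a = ρ a := rfl
  refine ⟨f.GNS, inferInstance, inferInstance, inferInstance, f.gnsStarAlgHom,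
    (f.toPreGNS 1 : f.PreGNS), ?_, fun a ↦ ?_⟩
  · rw [UniformSpace.Completion.norm_coe, PositiveLinearMap.preGNS_norm_def]
    simp [hf, hρ.2]
  · simp [PositiveLinearMap.preGNS_inner_def, hf]

/-- The vector argument is applied to the images of the generated algebras, since `M.𝒜` and `M.𝒞`
themselves may be infinite-dimensional. -/
theorem ReducedModel.hasMatrixRealization (M : ReducedModel.{u} p) (hM : M.OuterFinite) :
    HasMatrixRealization p := by
  obtain ⟨hMA, hMC⟩ := hM
  obtain ⟨H, _, _, _, π, Ω, hΩ, hρ⟩ := M.state.exists_gns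
  have hA : ∀ a ∈ generatedByPOVMs M.A, a ∈ M.𝒜 :=
    generatedCStar_le M.closedA (by rintro _ ⟨x, i, rfl⟩; exact M.A_mem x i)
  have hC : ∀ a ∈ generatedByPOVMs M.C, a ∈ M.𝒞 :=
    generatedCStar_le M.closedC (by rintro _ ⟨x, i, rfl⟩; exact M.C_mem x i)
  have hfin (N : StarSubalgebra ℂ M.D) [FiniteDimensional ℂ N] : FiniteDimensional ℂ (N.map π) := by
    have : FiniteDimensional ℂ N.toSubalgebra.toSubmodule := ‹FiniteDimensional ℂ N›
    exact inferInstanceAs (FiniteDimensional ℂ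
      (N.toSubalgebra.toSubmodule.map (π : M.D →ₗ[ℂ] (H →L[ℂ] H))))
  have := hfin (generatedByPOVMs M.A)
  have := hfin (generatedByPOVMs M.C)
  refine (hasDensityRealization_of_vector (p := p) ((generatedByPOVMs M.A).map π)
    ((generatedByPOVMs M.C).map π) ?_ hΩ ?_ (A := fun x i ↦ π (M.A x i))
    (B := fun y j ↦ π (M.B y j)) (C := fun z k ↦ π (M.C z k))
    (fun x i ↦ ⟨_, mem_generatedByPOVMs _ x i, rfl⟩)
    (fun x i ↦ ⟨_, mem_generatedByPOVMs _ x i, rfl⟩) (fun x ↦ (M.povmA x).map π)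
    (fun x ↦ (M.povmB x).map π) (fun x ↦ (M.povmC x).map π) ?_ ?_ ?_).hasMatrixRealization
  · rintro _ ⟨a, ha, rfl⟩ _ ⟨c, hc, rfl⟩
    exact (M.comm_A_C a (hA a ha) c (hC c hc)).map π
  · rintro _ ⟨a, ha, rfl⟩ _ ⟨c, hc, rfl⟩
    change inner ℂ Ω ((π a * π c) Ω) = inner ℂ Ω (π a Ω) * inner ℂ Ω (π c Ω)
    rw [← map_mul, hρ, hρ, hρ, M.factor a (hA a ha) c (hC c hc)]
  · rintro y j _ ⟨a, ha, rfl⟩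
    exact (M.comm_A_B a (hA a ha) _ (M.B_mem y j)).symm.map π
  · rintro y j _ ⟨c, hc, rfl⟩
    exact (M.comm_B_C _ (M.B_mem y j) c (hC c hc)).map π
  · intro i j k x y z
    rw [M.prob, ← map_mul, ← map_mul, hρ]

/-- The reduced model on the algebras generated by pairwise commuting POVMs. -/
theorem hasMatrixRealization_of_state {D : Type u} [CStarAlgebra D] {A : X → α → D} {B : Y → β → D}
    {C : Z → γ → D} (povmA : ∀ x, IsPOVM (A x)) (povmB : ∀ y, IsPOVM (B y))
    (povmC : ∀ z, IsPOVM (C z)) (hAB : ∀ x i y j, Commute (A x i) (B y j))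
    (hAC : ∀ x i z k, Commute (A x i) (C z k)) (hBC : ∀ y j z k, Commute (B y j) (C z k))
    {ρ : D →ₗ[ℂ] ℂ} (hρ : IsState ρ)
    (hfac : ∀ a ∈ generatedByPOVMs A, ∀ c ∈ generatedByPOVMs C, ρ (a * c) = ρ a * ρ c)
    (hp : ∀ i j k x y z, (p i j k x y z : ℂ) = ρ (A x i * B y j * C z k))
    (hA : FiniteDimensional ℂ (generatedByPOVMs A))
    (hC : FiniteDimensional ℂ (generatedByPOVMs C)) : HasMatrixRealization p := by
  -- Commutation passes from generators to generated algebras one side at a time.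
  have hcomm {X' Y' α' β' : Type v} [Fintype α'] [Fintype β'] {E : X' → α' → D} {F : Y' → β' → D}
      (hE : ∀ x, IsPOVM (E x)) (hF : ∀ y, IsPOVM (F y)) (hEF : ∀ x i y j, Commute (E x i) (F y j)) :
      MutuallyCommute (generatedByPOVMs E : Set D) (generatedByPOVMs F : Set D) := by
    have h1 : ∀ a ∈ generatedByPOVMs E, ∀ y j, Commute a (F y j) := by
      intro a ha y j
      refine commute_of_mem_generatedCStar (T := {t | ∃ y j, t = F y j}) ?_ ?_ a ha _ ⟨y, j, rfl⟩
      · rintro _ ⟨y, j, rfl⟩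
        exact ⟨y, j, (hF y).star_eq j⟩
      · rintro _ ⟨x, i, rfl⟩ _ ⟨y, j, rfl⟩
        exact hEF x i y j
    intro a ha b hb
    refine (commute_of_mem_generatedCStar (T := generatedByPOVMs E) (fun t ht ↦ star_mem ht) ?_
      b hb a ha).symm
    rintro _ ⟨y, j, rfl⟩ t ht
    exact (h1 t ht y j).symm
  exact ReducedModel.hasMatrixRealization (p := p)
    { D := D
      𝒜 := generatedByPOVMs A
      ℬ := generatedByPOVMs B
      𝒞 := generatedByPOVMs C
      closedA := isClosed_generatedCStar _
      closedB := isClosed_generatedCStar _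
      closedC := isClosed_generatedCStar _
      comm_A_B := hcomm povmA povmB hAB
      comm_A_C := hcomm povmA povmC hAC
      comm_B_C := hcomm povmB povmC hBC
      A, B, C, povmA, povmB, povmC
      A_mem := mem_generatedByPOVMs A
      B_mem := mem_generatedByPOVMs B
      C_mem := mem_generatedByPOVMs C
      ρ := ρ
      state := hρ
      factor := hfac
      prob := hp } ⟨hA, hC⟩

end

end

end Bilocal

namespace Bilocal

noncomputable section

/-! ### Operators on Hilbert space tensor products -/

section HTensor

variable {E F G K : Type u} [NormedAddCommGroup E] [InnerProductSpace ℂ E]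
  [NormedAddCommGroup F] [InnerProductSpace ℂ F] [NormedAddCommGroup G] [InnerProductSpace ℂ G]
  [NormedAddCommGroup K] [InnerProductSpace ℂ K]

/-- The simple tensor `x ⊗ y` in the Hilbert space tensor product, linear in `y`. -/
def tprodL (x : E) : F →L[ℂ] HTensor E F :=
  UniformSpace.Completion.toComplL.comp (TensorProduct.mkL ℂ E F x)

/-- The simple tensor `x ⊗ y` in the Hilbert space tensor product. -/
def tprod (x : E) (y : F) : HTensor E F := ((x ⊗ₜ[ℂ] y : E ⊗[ℂ] F) : HTensor E F)

/-- The simple tensor `x ⊗ y` in the Hilbert space tensor product, linear in `x`. -/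
def tprodR (y : F) : E →L[ℂ] HTensor E F :=
  UniformSpace.Completion.toComplL.comp ((TensorProduct.mkL ℂ E F).flip y)

theorem tprod_sum_left {ι : Type*} (s : Finset ι) (x : ι → E) (y : F) :
    tprod (∑ i ∈ s, x i) y = ∑ i ∈ s, tprod (x i) y := map_sum (tprodR y) x s

theorem tprod_sum_right {ι : Type*} (s : Finset ι) (x : E) (y : ι → F) :
    tprod x (∑ i ∈ s, y i) = ∑ i ∈ s, tprod x (y i) := map_sum (tprodL x) y s

theorem tprod_smul_left (c : ℂ) (x : E) (y : F) : tprod (c • x) y = c • tprod x y :=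
  map_smul (tprodR y) c x

theorem tprod_smul_right (c : ℂ) (x : E) (y : F) : tprod x (c • y) = c • tprod x y :=
  map_smul (tprodL x) c y

theorem inner_tprod (x x' : E) (y y' : F) :
    inner ℂ (tprod x y) (tprod x' y') = inner ℂ x x' * inner ℂ y y' := by
  rw [tprod, tprod, UniformSpace.Completion.inner_coe, TensorProduct.inner_tmul]

theorem norm_tprod (x : E) (y : F) : ‖tprod x y‖ = ‖x‖ * ‖y‖ := by
  rw [tprod, UniformSpace.Completion.norm_coe, TensorProduct.norm_tmul]

theorem ext_tprod {V : Type*} [NormedAddCommGroup V] [NormedSpace ℂ V] {S T : HTensor E F →L[ℂ] V}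
    (h : ∀ x y, S (tprod x y) = T (tprod x y)) : S = T := by
  ext z
  induction z using UniformSpace.Completion.induction_on with
  | hp => exact isClosed_eq S.continuous T.continuous
  | ih z =>
    induction z with
    | zero => rw [UniformSpace.Completion.coe_zero, map_zero, map_zero]
    | add x y hx hy => rw [UniformSpace.Completion.coe_add, map_add, map_add, hx, hy]
    | tmul x y => exact h x y

theorem ext_inner_tprod {u v : HTensor E F}
    (h : ∀ x y, (inner ℂ u (tprod x y) : ℂ) = inner ℂ v (tprod x y)) : u = v := by
  have : innerSL ℂ u = innerSL ℂ v := ext_tprod h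
  exact ext_inner_right ℂ fun w ↦ congrArg (fun S : HTensor E F →L[ℂ] ℂ ↦ S w) this

theorem ext_tprod_tprod {V : Type*} [NormedAddCommGroup V] [NormedSpace ℂ V]
    {S T : HTensor (HTensor E F) (HTensor G K) →L[ℂ] V}
    (h : ∀ x y z w, S (tprod (tprod x y) (tprod z w)) = T (tprod (tprod x y) (tprod z w))) :
    S = T := by
  refine ext_tprod fun u v ↦ ?_
  have h1 (x : E) (y : F) : S.comp (tprodL (tprod x y)) = T.comp (tprodL (tprod x y)) :=
    ext_tprod fun z w ↦ h x y z w
  have h2 : S.comp (tprodR v) = T.comp (tprodR v) :=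
    ext_tprod fun x y ↦ congrArg (fun R : HTensor G K →L[ℂ] V ↦ R v) (h1 x y)
  exact congrArg (fun R : HTensor E F →L[ℂ] V ↦ R u) h2

theorem opTensor_tprod (f : E →L[ℂ] E) (g : F →L[ℂ] F) (x : E) (y : F) :
    opTensor f g (tprod x y) = tprod (f x) (g y) := opTensor_tmul f g x y

theorem opTensor_one_one : opTensor (1 : E →L[ℂ] E) (1 : F →L[ℂ] F) = 1 :=
  ext_tprod fun x y ↦ by rw [opTensor_tprod]; rfl

theorem opTensor_mul (f f' : E →L[ℂ] E) (g g' : F →L[ℂ] F) :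
    opTensor (f * f') (g * g') = opTensor f g * opTensor f' g' :=
  ext_tprod fun x y ↦ by
    rw [mul_apply_eq_comp, opTensor_tprod, opTensor_tprod, opTensor_tprod]; rfl

theorem opTensor_add_left (f f' : E →L[ℂ] E) (g : F →L[ℂ] F) :
    opTensor (f + f') g = opTensor f g + opTensor f' g :=
  ext_tprod fun x y ↦ by
    rw [_root_.add_apply, opTensor_tprod, opTensor_tprod, opTensor_tprod, _root_.add_apply]
    exact map_add (tprodR (g y)) _ _

theorem opTensor_add_right (f : E →L[ℂ] E) (g g' : F →L[ℂ] F) :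
    opTensor f (g + g') = opTensor f g + opTensor f g' :=
  ext_tprod fun x y ↦ by
    rw [_root_.add_apply, opTensor_tprod, opTensor_tprod, opTensor_tprod, _root_.add_apply]
    exact map_add (tprodL (f x)) _ _

theorem opTensor_smul_left (c : ℂ) (f : E →L[ℂ] E) (g : F →L[ℂ] F) :
    opTensor (c • f) g = c • opTensor f g :=
  ext_tprod fun x y ↦ by
    rw [_root_.smul_apply, opTensor_tprod, opTensor_tprod, _root_.smul_apply]
    exact tprod_smul_left _ _ _

theorem opTensor_smul_right (c : ℂ) (f : E →L[ℂ] E) (g : F →L[ℂ] F) :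
    opTensor f (c • g) = c • opTensor f g :=
  ext_tprod fun x y ↦ by
    rw [_root_.smul_apply, opTensor_tprod, opTensor_tprod, _root_.smul_apply]
    exact tprod_smul_right _ _ _

theorem opTensor_rankOne (x x' : E) (y y' : F) :
    opTensor (InnerProductSpace.rankOne ℂ x x') (InnerProductSpace.rankOne ℂ y y') =
      InnerProductSpace.rankOne ℂ (tprod x y) (tprod x' y') :=
  ext_tprod fun u v ↦ by
    rw [opTensor_tprod, InnerProductSpace.rankOne_apply, InnerProductSpace.rankOne_apply,
      InnerProductSpace.rankOne_apply, inner_tprod, tprod_smul_left, tprod_smul_right, smul_smul]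

theorem conjBy_mul (U : E ≃ₗᵢ[ℂ] F) (S T : E →L[ℂ] E) :
    conjBy U (S * T) = conjBy U S * conjBy U T := by
  ext x
  simp [conjBy]

theorem inner_conjBy (U : E ≃ₗᵢ[ℂ] F) (T : E →L[ℂ] E) (x y : F) :
    inner ℂ x (conjBy U T y) = inner ℂ (U.symm x) (T (U.symm y)) := by
  change inner ℂ x (U (T (U.symm y))) = _
  rw [LinearIsometryEquiv.inner_map_eq_flip, LinearIsometryEquiv.symm_symm]

theorem assocUnitary_tprod (x : E) (y : F) (z : G) :
    assocUnitary E F G (tprod (tprod x y) z) = tprod x (tprod y z) := assocUnitary_tmul E F G x y z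

theorem assocUnitary_symm_tprod (x : E) (y : F) (z : G) :
    (assocUnitary E F G).symm (tprod x (tprod y z)) = tprod (tprod x y) z := by
  rw [← assocUnitary_tprod, LinearIsometryEquiv.symm_apply_apply]

theorem opTensorMiddle_mul (a a' : E →L[ℂ] E) (b b' : HTensor F G →L[ℂ] HTensor F G)
    (c c' : K →L[ℂ] K) :
    opTensorMiddle (a * a') (b * b') (c * c') =
      opTensorMiddle a b c * opTensorMiddle a' b' c' := by
  simp only [opTensorMiddle, opTensor_mul, conjBy_mul]

theorem inner_opTensorMiddle (a : E →L[ℂ] E) (b : HTensor F G →L[ℂ] HTensor F G) (c : K →L[ℂ] K)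
    (x x' : E) (y y' : F) (z z' : G) (w w' : K) :
    inner ℂ (tprod (tprod x y) (tprod z w))
        (opTensorMiddle a b c (tprod (tprod x' y') (tprod z' w'))) =
      inner ℂ x (a x') * (inner ℂ (tprod y z) (b (tprod y' z')) * inner ℂ w (c w')) := by
  rw [opTensorMiddle, inner_conjBy, LinearIsometryEquiv.symm_symm, assocUnitary_tprod,
    assocUnitary_tprod, opTensor_tprod, inner_tprod, inner_conjBy, assocUnitary_symm_tprod,
    assocUnitary_symm_tprod, opTensor_tprod, inner_tprod]

/-- On simple tensors both reassociations only move brackets. This formula exhibits the locality of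
Bob's operators. -/
theorem opTensorMiddle_opTensor (a : E →L[ℂ] E) (b : F →L[ℂ] F) (b' : G →L[ℂ] G) (c : K →L[ℂ] K) :
    opTensorMiddle a (opTensor b b') c = opTensor (opTensor a b) (opTensor b' c) := by
  refine ext_tprod_tprod fun x y z w ↦ ?_
  change (assocUnitary E F (HTensor G K)).symm (opTensor a
    (conjBy (assocUnitary F G K) (opTensor (opTensor b b') c))
    ((assocUnitary E F (HTensor G K)) (tprod (tprod x y) (tprod z w)))) = _
  rw [assocUnitary_tprod, opTensor_tprod]
  change (assocUnitary E F (HTensor G K)).symm (tprod (a x) (assocUnitary F G K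
    (opTensor (opTensor b b') c ((assocUnitary F G K).symm (tprod y (tprod z w)))))) = _
  rw [assocUnitary_symm_tprod, opTensor_tprod, opTensor_tprod, assocUnitary_tprod,
    assocUnitary_symm_tprod, opTensor_tprod, opTensor_tprod, opTensor_tprod]

theorem opTensorMiddle_left (a : E →L[ℂ] E) :
    opTensorMiddle a (1 : HTensor F G →L[ℂ] HTensor F G) (1 : K →L[ℂ] K) =
      opTensor (opTensor a 1) 1 := by
  rw [← opTensor_one_one, opTensorMiddle_opTensor, opTensor_one_one]

theorem opTensorMiddle_right (c : K →L[ℂ] K) :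
    opTensorMiddle (1 : E →L[ℂ] E) (1 : HTensor F G →L[ℂ] HTensor F G) c =
      opTensor 1 (opTensor 1 c) := by
  rw [← opTensor_one_one, opTensorMiddle_opTensor, opTensor_one_one]

theorem opTensorMiddle_eq (a : E →L[ℂ] E) (b : HTensor F G →L[ℂ] HTensor F G) (c : K →L[ℂ] K) :
    opTensorMiddle a b c =
      opTensor (opTensor a 1) 1 * opTensorMiddle 1 b 1 * opTensor 1 (opTensor 1 c) := by
  rw [← opTensorMiddle_left, ← opTensorMiddle_right, ← opTensorMiddle_mul,
    ← opTensorMiddle_mul, mul_one, mul_one, mul_one, one_mul, one_mul, one_mul]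

theorem commute_left_middle (a : E →L[ℂ] E) (b : HTensor F G →L[ℂ] HTensor F G) :
    Commute (opTensor (opTensor a 1) 1) (opTensorMiddle (1 : E →L[ℂ] E) b (1 : K →L[ℂ] K)) := by
  rw [commute_iff_eq, ← opTensorMiddle_left, ← opTensorMiddle_mul, ← opTensorMiddle_mul, mul_one,
    mul_one, mul_one, one_mul, one_mul]

theorem commute_middle_right (b : HTensor F G →L[ℂ] HTensor F G) (c : K →L[ℂ] K) :
    Commute (opTensorMiddle (1 : E →L[ℂ] E) b (1 : K →L[ℂ] K)) (opTensor 1 (opTensor 1 c)) := by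
  rw [commute_iff_eq, ← opTensorMiddle_right, ← opTensorMiddle_mul, ← opTensorMiddle_mul, mul_one,
    mul_one, mul_one, one_mul, one_mul]

theorem commute_opTensor (f : E →L[ℂ] E) (g : F →L[ℂ] F) :
    Commute (opTensor f 1) (opTensor 1 g) := by
  rw [commute_iff_eq, ← opTensor_mul, ← opTensor_mul, mul_one, mul_one, one_mul, one_mul]

variable [CompleteSpace E] [CompleteSpace F] [CompleteSpace G] [CompleteSpace K]

theorem opTensor_star (f : E →L[ℂ] E) (g : F →L[ℂ] F) :
    star (opTensor f g) = opTensor (star f) (star g) :=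
  ext_tprod fun x y ↦ ext_inner_tprod fun u v ↦ by
    rw [ContinuousLinearMap.star_eq_adjoint, ContinuousLinearMap.adjoint_inner_left,
      opTensor_tprod, opTensor_tprod, inner_tprod, inner_tprod,
      ContinuousLinearMap.star_eq_adjoint, ContinuousLinearMap.star_eq_adjoint,
      ContinuousLinearMap.adjoint_inner_left, ContinuousLinearMap.adjoint_inner_left]

variable (F) in
/-- The representation `f ↦ f ⊗ 1`. -/
def opLeft : (E →L[ℂ] E) →⋆ₐ[ℂ] (HTensor E F →L[ℂ] HTensor E F) where
  toFun f := opTensor f 1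
  map_one' := opTensor_one_one
  map_mul' f g := by rw [← opTensor_mul, mul_one]
  map_zero' := by simpa using opTensor_smul_left 0 (0 : E →L[ℂ] E) (1 : F →L[ℂ] F)
  map_add' f g := opTensor_add_left f g 1
  commutes' r := by
    rw [Algebra.algebraMap_eq_smul_one, opTensor_smul_left, opTensor_one_one,
      Algebra.algebraMap_eq_smul_one]
  map_star' f := by rw [opTensor_star, star_one]

variable (E) in
/-- The representation `g ↦ 1 ⊗ g`. -/
def opRight : (F →L[ℂ] F) →⋆ₐ[ℂ] (HTensor E F →L[ℂ] HTensor E F) where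
  toFun g := opTensor 1 g
  map_one' := opTensor_one_one
  map_mul' f g := by rw [← opTensor_mul, mul_one]
  map_zero' := by simpa using opTensor_smul_right 0 (1 : E →L[ℂ] E) (0 : F →L[ℂ] F)
  map_add' f g := opTensor_add_right 1 f g
  commutes' r := by
    rw [Algebra.algebraMap_eq_smul_one, opTensor_smul_right, opTensor_one_one,
      Algebra.algebraMap_eq_smul_one]
  map_star' f := by rw [opTensor_star, star_one]

/-- Conjugation by a unitary, as a homomorphism. -/
def conjHom (U : E ≃ₗᵢ[ℂ] F) : (E →L[ℂ] E) →⋆ₐ[ℂ] (F →L[ℂ] F) where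
  toFun := conjBy U
  map_one' := map_one U.conjStarAlgEquiv
  map_mul' := map_mul U.conjStarAlgEquiv
  map_zero' := map_zero U.conjStarAlgEquiv
  map_add' := map_add U.conjStarAlgEquiv
  commutes' r := by ext x; simp [conjBy, Algebra.algebraMap_eq_smul_one]
  map_star' := map_star U.conjStarAlgEquiv

variable (E K) in
/-- The representation `b ↦ 1 ⊗ b ⊗ 1`. -/
def opMiddle : (HTensor F G →L[ℂ] HTensor F G) →⋆ₐ[ℂ]
    (HTensor (HTensor E F) (HTensor G K) →L[ℂ] HTensor (HTensor E F) (HTensor G K)) :=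
  (conjHom (assocUnitary E F (HTensor G K)).symm).comp
    ((opRight E).comp ((conjHom (assocUnitary F G K)).comp (opLeft K)))

/-! ### Orthonormal bases of tensor products -/

theorem _root_.HilbertBasis.clm_eq_zero {ι V : Type*} [NormedAddCommGroup V]
    [InnerProductSpace ℂ V] (b : HilbertBasis ι ℂ V) {S : V →L[ℂ] ℂ} (hS : ∀ i, S (b i) = 0)
    (x : V) : S x = 0 := by
  have h : Submodule.span ℂ (Set.range b) ≤ LinearMap.ker (S : V →ₗ[ℂ] ℂ) := by
    rw [Submodule.span_le]
    rintro _ ⟨i, rfl⟩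
    exact hS i
  have hcl : (Submodule.span ℂ (Set.range b)).topologicalClosure ≤
      LinearMap.ker (S : V →ₗ[ℂ] ℂ) :=
    Submodule.topologicalClosure_minimal _ h (ContinuousLinearMap.isClosed_ker S)
  rw [b.dense_span] at hcl
  exact hcl (Submodule.mem_top (x := x))

/-- The basis `e i ⊗ f j` of the Hilbert space tensor product. -/
def hilbertBasisTensor {ι κ : Type*} (e : HilbertBasis ι ℂ E) (f : HilbertBasis κ ℂ F) :
    HilbertBasis (ι × κ) ℂ (HTensor E F) :=
  HilbertBasis.mkOfOrthogonalEqBot (v := fun q ↦ tprod (e q.1) (f q.2))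
    (by
      classical
      rw [orthonormal_iff_ite]
      rintro ⟨i, k⟩ ⟨j, l⟩
      rw [inner_tprod, orthonormal_iff_ite.1 e.orthonormal, orthonormal_iff_ite.1 f.orthonormal]
      by_cases h : i = j <;> by_cases h' : k = l <;> simp [h, h'])
    (by
      rw [eq_bot_iff]
      intro u hu
      rw [Submodule.mem_orthogonal'] at hu
      -- Orthogonality to the products of basis vectors is extended one factor at a time, each time
      -- as a continuous functional vanishing on a basis.
      have h1 (i : ι) (y : F) : inner ℂ u (tprod (e i) y) = 0 :=
        f.clm_eq_zero (S := (innerSL ℂ u).comp (tprodL (e i)))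
          (fun j ↦ hu _ (Submodule.subset_span ⟨(i, j), rfl⟩)) y
      have h2 (x : E) (y : F) : inner ℂ u (tprod x y) = 0 :=
        e.clm_eq_zero (S := (innerSL ℂ u).comp (tprodR y)) (fun i ↦ h1 i y) x
      exact ext_inner_tprod fun x y ↦ by rw [h2, inner_zero_left])

omit [CompleteSpace E] [CompleteSpace F] in
theorem hilbertBasisTensor_apply {ι κ : Type*} (e : HilbertBasis ι ℂ E) (f : HilbertBasis κ ℂ F)
    (q : ι × κ) : hilbertBasisTensor e f q = tprod (e q.1) (f q.2) := by
  rw [hilbertBasisTensor, HilbertBasis.coe_mkOfOrthogonalEqBot]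

end HTensor

/-! ### Traces and states -/

section Trace

variable {H : Type u} [NormedAddCommGroup H] [InnerProductSpace ℂ H]

theorem hasSum_norm_inner_sq {ι : Type*} (b : HilbertBasis ι ℂ H) (x : H) :
    HasSum (fun i ↦ ‖(inner ℂ (b i) x : ℂ)‖ ^ 2) (‖x‖ ^ 2) := by
  have h := b.hasSum_inner_mul_inner x x
  have h1 (i : ι) : (inner ℂ x (b i) * inner ℂ (b i) x : ℂ) =
      ((‖(inner ℂ (b i) x : ℂ)‖ ^ 2 : ℝ) : ℂ) := by
    rw [← inner_conj_symm x (b i), ← Complex.normSq_eq_conj_mul_self, Complex.normSq_eq_norm_sq]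
  simp only [h1] at h
  rw [inner_self_eq_norm_sq_to_K, ← RCLike.ofReal_pow] at h
  exact Complex.hasSum_ofReal.1 h

variable [CompleteSpace H]

/-- Parseval's identity for `star T ψ` and `ψ` gives the same value in every basis. -/
theorem hasTrace_rankOne_mul (ψ : H) (T : H →L[ℂ] H) :
    HasTrace (InnerProductSpace.rankOne ℂ ψ ψ * T) (inner ℂ ψ (T ψ)) := by
  intro ι e
  have h := e.hasSum_inner_mul_inner (star T ψ) ψ
  simp only [inner_star_left, star_star] at h
  have heq (i : ι) : inner ℂ (e i) ((InnerProductSpace.rankOne ℂ ψ ψ * T) (e i)) =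
      inner ℂ ψ (T (e i)) * inner ℂ (e i) ψ := by
    rw [mul_apply_eq_comp, InnerProductSpace.rankOne_apply, inner_smul_right]
  simpa only [heq] using h

theorem HasTrace.unique {T : H →L[ℂ] H} {s t : ℂ} (hs : HasTrace T s) (ht : HasTrace T t) :
    s = t := by
  obtain ⟨w, b, -⟩ := exists_hilbertBasis ℂ H
  exact (hs w b).unique (ht w b)

omit [CompleteSpace H] in
theorem summable_inner_of_summable_norm_sq {κ : Type*} {ξ : κ → H}
    (hξ : Summable fun k ↦ ‖ξ k‖ ^ 2) (T : H →L[ℂ] H) :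
    Summable fun k ↦ ‖(inner ℂ (ξ k) (T (ξ k)) : ℂ)‖ := by
  refine Summable.of_nonneg_of_le (fun _ ↦ norm_nonneg _) (fun k ↦ ?_) (hξ.mul_left ‖T‖)
  calc ‖(inner ℂ (ξ k) (T (ξ k)) : ℂ)‖ ≤ ‖ξ k‖ * ‖T (ξ k)‖ := norm_inner_le_norm _ _
    _ ≤ ‖ξ k‖ * (‖T‖ * ‖ξ k‖) := by gcongr; exact T.le_opNorm _
    _ = ‖T‖ * ‖ξ k‖ ^ 2 := by ring

/-- The functional `T ↦ ∑ k, ⟪ξ k, T (ξ k)⟫` of a square summable family of vectors. -/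
def familyState {κ : Type*} (ξ : κ → H) (hξ : Summable fun k ↦ ‖ξ k‖ ^ 2) :
    (H →L[ℂ] H) →ₗ[ℂ] ℂ where
  toFun T := ∑' k, inner ℂ (ξ k) (T (ξ k))
  map_add' S T := by
    rw [← (summable_inner_of_summable_norm_sq hξ S).of_norm.tsum_add
      (summable_inner_of_summable_norm_sq hξ T).of_norm]
    simp only [_root_.add_apply, inner_add_right]
  map_smul' c T := by
    simp only [_root_.smul_apply, inner_smul_right, tsum_mul_left]
    rfl

omit [CompleteSpace H] in
theorem familyState_apply {κ : Type*} (ξ : κ → H) (hξ : Summable fun k ↦ ‖ξ k‖ ^ 2)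
    (T : H →L[ℂ] H) : familyState ξ hξ T = ∑' k, inner ℂ (ξ k) (T (ξ k)) := rfl

omit [CompleteSpace H] in
theorem familyState_one {κ : Type*} {ξ : κ → H} {t : ℝ} (h : HasSum (fun k ↦ ‖ξ k‖ ^ 2) t) :
    familyState ξ h.summable 1 = t := by
  rw [familyState_apply, ← h.tsum_eq, Complex.ofReal_tsum]
  simp only [one_apply_eq_self, inner_self_eq_norm_sq_to_K]
  push_cast
  rfl

theorem isState_familyState {κ : Type*} {ξ : κ → H} (h : HasSum (fun k ↦ ‖ξ k‖ ^ 2) 1) :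
    IsState (familyState ξ h.summable) := by
  refine ⟨fun b ↦ tsum_nonneg fun k ↦ ?_, by rw [familyState_one h, Complex.ofReal_one]⟩
  rw [mul_apply_eq_comp, ← inner_star_left, inner_self_eq_norm_sq_to_K]
  norm_cast
  positivity

/-- Cyclicity of the trace for the product of two Hilbert-Schmidt operators. -/
theorem eq_familyState_of_hasSum {ι : Type*} (g : HilbertBasis ι ℂ H) {S X : H →L[ℂ] H}
    (hS : star S = S) (hsum : Summable fun k ↦ ‖S (g k)‖ ^ 2) {t : ℂ}
    (ht : HasSum (fun k ↦ inner ℂ (g k) ((S * S * X) (g k))) t) :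
    t = familyState (fun k ↦ S (g k)) hsum X := by
  let V : ι → H := fun l ↦ star X (S (g l))
  -- The row sums of `Φ` give the functional, the column sums the trace. Both factors are square
  -- summable arrays because `S` is Hilbert–Schmidt, so the sums may be exchanged.
  let Φ : ι × ι → ℂ := fun q ↦ inner ℂ (V q.1) (g q.2) * inner ℂ (g q.2) (S (g q.1))
  have hb1 : Summable fun q : ι × ι ↦ ‖(inner ℂ (g q.2) (S (g q.1)) : ℂ)‖ ^ 2 := by
    rw [summable_prod_of_nonneg fun q ↦ by positivity]
    refine ⟨fun l ↦ (hasSum_norm_inner_sq g (S (g l))).summable, ?_⟩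
    simpa only [(hasSum_norm_inner_sq g _).tsum_eq] using hsum
  have hb2 : Summable fun q : ι × ι ↦ ‖(inner ℂ (g q.2) (V q.1) : ℂ)‖ ^ 2 := by
    rw [summable_prod_of_nonneg fun q ↦ by positivity]
    refine ⟨fun l ↦ (hasSum_norm_inner_sq g (V l)).summable, ?_⟩
    simp only [(hasSum_norm_inner_sq g _).tsum_eq]
    refine Summable.of_nonneg_of_le (fun _ ↦ by positivity) (fun l ↦ ?_)
      (hsum.mul_left (‖star X‖ ^ 2))
    rw [← mul_pow]
    gcongr
    exact (star X).le_opNorm (S (g l))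
  have hΦ : Summable Φ := by
    refine Summable.of_norm_bounded (hb1.add hb2) fun q ↦ ?_
    rw [norm_mul, norm_inner_symm (V q.1)]
    nlinarith [sq_nonneg (‖(inner ℂ (g q.2) (V q.1) : ℂ)‖ - ‖(inner ℂ (g q.2) (S (g q.1)) : ℂ)‖),
      sq_nonneg (‖(inner ℂ (g q.2) (V q.1) : ℂ)‖), sq_nonneg (‖(inner ℂ (g q.2) (S (g q.1)) : ℂ)‖)]
  have hrow (l : ι) : ∑' k, Φ (l, k) = inner ℂ (S (g l)) (X (S (g l))) := by
    rw [(g.hasSum_inner_mul_inner (V l) (S (g l))).tsum_eq, inner_star_left, star_star]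
  have hcol (k : ι) : ∑' l, Φ (l, k) = inner ℂ (g k) ((S * S * X) (g k)) := by
    have h := (g.hasSum_inner_mul_inner (S (g k)) (S (X (g k)))).tsum_eq
    rw [inner_star_left, hS] at h
    refine Eq.trans (tsum_congr fun l ↦ ?_) h
    simp only [Φ, V]
    rw [inner_star_left, star_star, inner_star_left, hS, mul_comm]
    congr 1
    rw [inner_star_left, hS]
  rw [← ht.tsum_eq, familyState_apply, ← tsum_congr hcol, ← tsum_congr hrow]
  exact hΦ.tsum_comm (f := fun l k ↦ Φ (l, k))

theorem exists_normal_state {ι : Type*} (g : HilbertBasis ι ℂ H) {S : H →L[ℂ] H}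
    (hS : star S = S) (hsum : HasSum (fun k ↦ ‖S (g k)‖ ^ 2) 1) :
    ∃ ρ : (H →L[ℂ] H) →ₗ[ℂ] ℂ, IsState (R := H →L[ℂ] H) ρ ∧
      (∀ T t, HasSum (fun k ↦ inner ℂ (g k) ((S * S * T) (g k))) t → t = ρ T) ∧
      ∀ T, ρ T = ∑' k, inner ℂ (S (g k)) (T (S (g k))) :=
  ⟨familyState (fun k ↦ S (g k)) hsum.summable, isState_familyState hsum,
    fun _ _ ht ↦ eq_familyState_of_hasSum g hS hsum.summable ht, fun _ ↦ rfl⟩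

/-- Splitting `σ = S * S` allows `tr (σ T)` to be written as a sum of vector expectations, whose
positivity in `T` is manifest. -/
theorem IsDensityOperator.exists_sqrt {σ : H →L[ℂ] H} (hσ : IsDensityOperator σ) :
    ∃ S : H →L[ℂ] H, star S = S ∧ S * S = σ ∧
      ∀ {ι : Type u} (e : HilbertBasis ι ℂ H), HasSum (fun i ↦ ‖S (e i)‖ ^ 2) 1 := by
  have h0 : 0 ≤ σ := (ContinuousLinearMap.nonneg_iff_isPositive σ).2 hσ.1
  obtain ⟨S, hS, hSS⟩ := CStarAlgebra.nonneg_iff_exists_isSelfAdjoint_and_eq_mul_self.1 h0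
  refine ⟨S, hS.star_eq, hSS.symm, fun {ι} e ↦ ?_⟩
  have h := hσ.2 ι e
  have h1 (i : ι) : inner ℂ (e i) (σ (e i)) = ((‖S (e i)‖ ^ 2 : ℝ) : ℂ) := by
    rw [hSS, mul_apply_eq_comp, ← hS.star_eq, ← inner_star_left, hS.star_eq,
      inner_self_eq_norm_sq_to_K]
    push_cast
    rfl
  simp only [h1] at h
  exact Complex.hasSum_ofReal.1 (by simpa using h)

end Trace

section ProductState

variable {E F : Type u} [NormedAddCommGroup E] [InnerProductSpace ℂ E] [CompleteSpace E]
  [NormedAddCommGroup F] [InnerProductSpace ℂ F] [CompleteSpace F]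

/-- The normal state defined by a product of two density operators. -/
theorem exists_product_state {σ : E →L[ℂ] E} {σ' : F →L[ℂ] F} (hσ : IsDensityOperator σ)
    (hσ' : IsDensityOperator σ') :
    ∃ ρ : (HTensor E F →L[ℂ] HTensor E F) →ₗ[ℂ] ℂ,
      IsState (R := HTensor E F →L[ℂ] HTensor E F) ρ ∧
      (∀ T t, HasTrace (opTensor σ σ' * T) t → t = ρ T) ∧
      ∀ f g, ρ (opTensor f 1 * opTensor 1 g) = ρ (opTensor f 1) * ρ (opTensor 1 g) := by
  obtain ⟨S, hS, hSS, hsum⟩ := hσ.exists_sqrt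
  obtain ⟨S', hS', hSS', hsum'⟩ := hσ'.exists_sqrt
  obtain ⟨w, e, -⟩ := exists_hilbertBasis ℂ E
  obtain ⟨w', e', -⟩ := exists_hilbertBasis ℂ F
  let R := opTensor S S'
  have hR : star R = R := by rw [opTensor_star, hS, hS']
  have hRR : R * R = opTensor σ σ' := by rw [← opTensor_mul, hSS, hSS']
  let g := hilbertBasisTensor e e'
  have hg (q : w × w') : R (g q) = tprod (S (e q.1)) (S' (e' q.2)) := by
    rw [hilbertBasisTensor_apply, opTensor_tprod]
  have hs : HasSum (fun q ↦ ‖R (g q)‖ ^ 2) 1 := by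
    have h := (hsum e).mul (hsum' e') ((hsum e).summable.mul_of_nonneg
      (hsum' e').summable (fun _ ↦ by positivity) fun _ ↦ by positivity)
    simpa only [hg, norm_tprod, mul_pow, mul_one] using h
  obtain ⟨ρ, hρ, hρtr, hρa⟩ := exists_normal_state g hR hs
  -- In the product basis the double series is a product of two absolutely convergent series.
  have hprod (f : E →L[ℂ] E) (f' : F →L[ℂ] F) : ρ (opTensor f f') =
      familyState (fun i ↦ S (e i)) (hsum e).summable f *
        familyState (fun i ↦ S' (e' i)) (hsum' e').summable f' := by
    simp only [hρa, familyState_apply, hg, opTensor_tprod, inner_tprod]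
    exact (tsum_mul_tsum_of_summable_norm
      (summable_inner_of_summable_norm_sq (hsum e).summable f)
      (summable_inner_of_summable_norm_sq (hsum' e').summable f')).symm
  refine ⟨ρ, hρ, fun T t ht ↦ hρtr T t (by rw [hRR]; exact ht _ g), fun f f' ↦ ?_⟩
  rw [← opTensor_mul, mul_one, one_mul, hprod, hprod f 1, hprod 1 f', familyState_one (hsum e),
    familyState_one (hsum' e'), Complex.ofReal_one, one_mul, mul_one]

end ProductState

/-! ### Commutation under weak operator limits. -/

section WOT

variable {H : Type u} [NormedAddCommGroup H] [InnerProductSpace ℂ H] [CompleteSpace H]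

/-- Moving `a` to the other side of the inner product as `star a` expresses commutation through
single matrix coefficients of `T`, which are continuous in the weak operator topology. -/
theorem commute_of_mem_closure_WOT {S : Set (H →L[ℂ] H)} {a T : H →L[ℂ] H}
    (hS : ∀ s ∈ S, Commute a s)
    (hT : ContinuousLinearMap.WOTofCLM T ∈ closure (ContinuousLinearMap.WOTofCLM '' S)) :
    Commute a T := by
  let Z : Set (H →WOT[ℂ] H) :=
    {R | ∀ x y, (inner ℂ (star a x) (R y) : ℂ) = inner ℂ x (R (a y))}
  have hZ : IsClosed Z := by
    simp only [Z, Set.ofPred_forall]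
    refine isClosed_iInter fun x ↦ isClosed_iInter fun y ↦ isClosed_eq ?_ ?_
    · exact ContinuousLinearMapWOT.continuous_iff.1 continuous_id _ _
    · exact ContinuousLinearMapWOT.continuous_iff.1 continuous_id _ _
  have hsub : ContinuousLinearMap.WOTofCLM '' S ⊆ Z := by
    rintro _ ⟨s, hs, rfl⟩ x y
    change inner ℂ (star a x) (s y) = inner ℂ x (s (a y))
    rw [inner_star_left, star_star]
    exact congrArg (fun R : H →L[ℂ] H ↦ (inner ℂ x (R y) : ℂ)) (hS s hs).eq
  have h : ∀ x y, (inner ℂ (star a x) (T y) : ℂ) = inner ℂ x (T (a y)) :=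
    closure_minimal hsub hZ hT
  rw [commute_iff_eq]
  ext y
  refine ext_inner_left ℂ fun x ↦ ?_
  rw [mul_apply_eq_comp, mul_apply_eq_comp, ← h x y, inner_star_left, star_star]

end WOT

/-! ### Reduction of the remaining models to matrices. -/

section Forward

variable {X Y Z α β γ : Type v} [Fintype α] [Fintype β] [Fintype γ]
  {p : α → β → γ → X → Y → Z → ℝ}

theorem CommutingModel.hasMatrixRealization (M : CommutingModel.{u} p) (hM : M.OuterFinite) :
    HasMatrixRealization p := by
  have hAgen : ∀ a ∈ generatedByPOVMs M.A, a ∈ M.𝒜 :=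
    generatedCStar_le M.closedA (by rintro _ ⟨x, i, rfl⟩; exact M.A_mem x i)
  have hCgen : ∀ a ∈ generatedByPOVMs M.C, a ∈ M.𝒞 :=
    generatedCStar_le M.closedC (by rintro _ ⟨x, i, rfl⟩; exact M.C_mem x i)
  refine hasMatrixRealization_of_state M.povmA M.povmB M.povmC (fun x i y j ↦ ?_)
    (fun x i z k ↦ M.comm_A_C _ (M.A_mem x i) _ (M.C_mem z k)) (fun y j z k ↦ ?_) M.state
    (fun a ha c hc ↦ ?_) M.prob hM.1 hM.2
  · refine (commute_of_mem_generatedCStar (T := (M.𝒜 : Set M.D)) (fun t ht ↦ star_mem ht) ?_ _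
      (M.B_mem y j) _ (M.A_mem x i)).symm
    rintro s (hs | hs) t ht
    · exact (M.comm_A_BA t ht s hs).symm
    · exact (M.comm_A_BC t ht s hs).symm
  · refine commute_of_mem_generatedCStar (T := (M.𝒞 : Set M.D)) (fun t ht ↦ star_mem ht) ?_ _
      (M.B_mem y j) _ (M.C_mem z k)
    rintro s (hs | hs) t ht
    · exact M.comm_BA_C s hs t ht
    · exact M.comm_BC_C s hs t ht
  -- Factorization between Alice and Charlie is the case where both of Bob's entries are `1`.
  · simpa only [mul_one, one_mul] using
      M.factor a (hAgen a ha) 1 (one_mem _) 1 (one_mem _) c (hCgen c hc)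

/-- The image of a finite-dimensional algebra is automatically closed, so it already contains the
C*-algebra generated by the image POVMs. -/
theorem generatedByPOVMs_map_le {R S : Type u} [CStarAlgebra R] [CStarAlgebra S]
    {X α : Type v} (A : X → α → R) (φ : R →⋆ₐ[ℂ] S) [FiniteDimensional ℂ (generatedByPOVMs A)] :
    FiniteDimensional ℂ (generatedByPOVMs fun x i ↦ φ (A x i)) ∧
      ∀ b ∈ generatedByPOVMs (fun x i ↦ φ (A x i)), ∃ a ∈ generatedByPOVMs A, φ a = b := by
  let W : Submodule ℂ R := (generatedByPOVMs A).toSubalgebra.toSubmodule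
  have : FiniteDimensional ℂ W := ‹FiniteDimensional ℂ (generatedByPOVMs A)›
  let W' : Submodule ℂ S := W.map (φ : R →ₗ[ℂ] S)
  have hle : generatedByPOVMs (fun x i ↦ φ (A x i)) ≤ (generatedByPOVMs A).map φ := by
    refine generatedCStar_le (W'.closed_of_finiteDimensional) ?_
    rintro _ ⟨x, i, rfl⟩
    exact ⟨_, mem_generatedByPOVMs A x i, rfl⟩
  refine ⟨?_, fun b hb ↦ hle hb⟩
  let V : Submodule ℂ S := (generatedByPOVMs fun x i ↦ φ (A x i)).toSubalgebra.toSubmodule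
  have hVW : V ≤ W' := hle
  exact Submodule.finiteDimensional_of_le hVW

theorem IsPOVM.map_operators {E H : Type u} {ι : Type v} [Fintype ι]
    [NormedAddCommGroup E] [InnerProductSpace ℂ E] [CompleteSpace E]
    [NormedAddCommGroup H] [InnerProductSpace ℂ H] [CompleteSpace H]
    {M : ι → (E →L[ℂ] E)} (h : IsPOVM M) (φ : (E →L[ℂ] E) →⋆ₐ[ℂ] (H →L[ℂ] H)) :
    IsPOVM fun i ↦ φ (M i) := h.map φ

theorem hasMatrixRealization_of_representations {E G H : Type u}
    [NormedAddCommGroup E] [InnerProductSpace ℂ E] [CompleteSpace E]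
    [NormedAddCommGroup G] [InnerProductSpace ℂ G] [CompleteSpace G]
    [NormedAddCommGroup H] [InnerProductSpace ℂ H] [CompleteSpace H]
    (φ : (E →L[ℂ] E) →⋆ₐ[ℂ] (H →L[ℂ] H)) (ψ : (G →L[ℂ] G) →⋆ₐ[ℂ] (H →L[ℂ] H))
    {A : X → α → (E →L[ℂ] E)} {B : Y → β → (H →L[ℂ] H)} {C : Z → γ → (G →L[ℂ] G)}
    (povmA : ∀ x, IsPOVM (A x)) (povmB : ∀ y, IsPOVM (B y)) (povmC : ∀ z, IsPOVM (C z))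
    (hAB : ∀ x i y j, Commute (φ (A x i)) (B y j)) (hAC : ∀ a c, Commute (φ a) (ψ c))
    (hBC : ∀ y j z k, Commute (B y j) (ψ (C z k)))
    {ρ : (H →L[ℂ] H) →ₗ[ℂ] ℂ} (hρ : IsState (R := H →L[ℂ] H) ρ)
    (hfac : ∀ a c, ρ (φ a * ψ c) = ρ (φ a) * ρ (ψ c))
    (hp : ∀ i j k x y z, (p i j k x y z : ℂ) = ρ (φ (A x i) * B y j * ψ (C z k)))
    (hA : FiniteDimensional ℂ (generatedByPOVMs A))
    (hC : FiniteDimensional ℂ (generatedByPOVMs C)) : HasMatrixRealization p := by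
  obtain ⟨hA', hAmem⟩ := generatedByPOVMs_map_le (S := H →L[ℂ] H) A φ
  obtain ⟨hC', hCmem⟩ := generatedByPOVMs_map_le (S := H →L[ℂ] H) C ψ
  refine hasMatrixRealization_of_state (A := fun x i ↦ φ (A x i)) (B := B)
    (C := fun z k ↦ ψ (C z k)) (fun x ↦ (povmA x).map φ) povmB (fun z ↦ (povmC z).map ψ) hAB
    (fun x i z k ↦ hAC _ _) hBC hρ ?_ hp hA' hC'
  intro a ha c hc
  obtain ⟨a, -, rfl⟩ := hAmem a ha
  obtain ⟨c, -, rfl⟩ := hCmem c hc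
  exact hfac a c

/-- Elementary tensors suffice: commutation extends linearly to their span and then to its weak
closure. -/
theorem MixedModel.commute_B (M : MixedModel.{u} p)
    {T : HTensor M.HAB M.HBC →L[ℂ] HTensor M.HAB M.HBC}
    (hT : ∀ a ∈ M.ℬA, ∀ b ∈ M.ℬC, Commute T (opTensor a b)) (y : Y) (j : β) :
    Commute T (M.B y j) := by
  refine commute_of_mem_closure_WOT (fun s hs ↦ ?_) (M.B_mem y j)
  induction hs using Submodule.span_induction with
  | mem x hx =>
    obtain ⟨a, ha, b, hb, rfl⟩ := hx
    exact hT a ha b hb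
  | zero => exact Commute.zero_right _
  | add x y _ _ hx hy => exact hx.add_right hy
  | smul r x _ hx => exact hx.smul_right r

theorem MixedModel.commute_A_B (M : MixedModel.{u} p) (x : X) (i : α) (y : Y) (j : β) :
    Commute (opTensor (M.A x i) 1) (M.B y j) :=
  M.commute_B (fun a ha b _ ↦ by
    rw [commute_iff_eq, ← opTensor_mul, ← opTensor_mul, one_mul, mul_one,
      (M.comm_A_BA _ (M.A_mem x i) a ha).eq]) y j

theorem MixedModel.commute_B_C (M : MixedModel.{u} p) (y : Y) (j : β) (z : Z) (k : γ) :
    Commute (M.B y j) (opTensor 1 (M.C z k)) :=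
  (M.commute_B (fun a _ b hb ↦ by
    rw [commute_iff_eq, ← opTensor_mul, ← opTensor_mul, one_mul, mul_one,
      (M.comm_BC_C b hb _ (M.C_mem z k)).eq]) y j).symm

theorem MixedModel.hasMatrixRealization (M : MixedModel.{u} p) (hM : M.OuterFinite) :
    HasMatrixRealization p := by
  obtain ⟨ρ, hρ, hρtr, hρprod⟩ := exists_product_state M.densityAB M.densityBC
  exact hasMatrixRealization_of_representations (opLeft M.HBC) (opRight M.HAB) M.povmA M.povmB
    M.povmC M.commute_A_B (fun a c ↦ commute_opTensor a c) M.commute_B_C hρ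
    (fun a c ↦ hρprod a c) (fun i j k x y z ↦ hρtr _ _ (M.prob i j k x y z)) hM.1 hM.2

theorem TensorModel.hasMatrixRealization (M : TensorModel.{u} p) (hM : M.OuterFinite) :
    HasMatrixRealization p := by
  obtain ⟨ρ, hρ, hρtr, hρprod⟩ := exists_product_state M.densityAB M.densityBC
  refine hasMatrixRealization_of_representations
    ((opLeft (HTensor M.HBC M.HC)).comp (opLeft M.HBA))
    ((opRight (HTensor M.HA M.HBA)).comp (opRight M.HBC))
    (B := fun y j ↦ opMiddle M.HA M.HC (M.B y j)) M.povmA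
    (fun y ↦ (M.povmB y).map_operators (opMiddle M.HA M.HC)) M.povmC
    (fun x i y j ↦ commute_left_middle (M.A x i) (M.B y j))
    (fun a c ↦ commute_opTensor (opTensor a 1) (opTensor 1 c))
    (fun y j z k ↦ commute_middle_right (M.B y j) (M.C z k)) hρ
    (fun a c ↦ ?_) (fun i j k x y z ↦ hρtr _ _ ?_) hM.1 hM.2
  · exact hρprod (opTensor a 1) (opTensor 1 c)
  · have h := M.prob i j k x y z
    rw [opTensorMiddle_eq] at h
    exact h

/-- Both projections fix `ψ`, so for `a` commuting with `Q` and `c` with `P` one has `⟪ψ, a c ψ⟫ =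
⟪ψ, a Q P c ψ⟫`. Since `Q P` is the rank-one projection onto `ψ`, the vector state factorizes. -/
theorem RenouXuModel.hasMatrixRealization (M : RenouXuModel.{u} p) (hM : M.OuterFinite) :
    HasMatrixRealization p := by
  obtain ⟨ψ, hψ, hPQ⟩ := M.rankOne_PQ
  let ξ : Unit → M.H := fun _ ↦ ψ
  have hξ : HasSum (fun k ↦ ‖ξ k‖ ^ 2) 1 := by
    simp [ξ, hψ]
  have hρ (T : M.H →L[ℂ] M.H) : familyState ξ hξ.summable T = inner ℂ ψ (T ψ) := by
    rw [familyState_apply, tsum_fintype]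
    simp [ξ]
  have hψψ : (inner ℂ ψ ψ : ℂ) = 1 := by rw [inner_self_eq_norm_sq_to_K, hψ]; simp
  have hPQψ : M.P (M.Q ψ) = ψ := by
    rw [← mul_apply_eq_comp, hPQ, InnerProductSpace.rankOne_apply, hψψ, one_smul]
  have hPψ : M.P ψ = ψ := by
    conv_lhs => rw [← hPQψ]
    rw [← mul_apply_eq_comp, M.projP.isIdempotentElem.eq, hPQψ]
  have hQψ : M.Q ψ = ψ := by
    have h : M.Q (M.P ψ) = ψ := by rw [← mul_apply_eq_comp, ← M.comm_P_Q.eq]; exact hPQψ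
    rwa [hPψ] at h
  refine hasMatrixRealization_of_state M.povmA M.povmB M.povmC M.comm_A_B M.comm_A_C M.comm_B_C
    (isState_familyState hξ) (fun a ha c hc ↦ ?_) (fun i j k x y z ↦ ?_) hM.1 hM.2
  · have haQ : Commute a M.Q := by
      refine commute_of_mem_generatedCStar (T := {M.Q}) ?_ ?_ a ha _ rfl
      · rintro _ rfl
        exact M.projQ.isSelfAdjoint
      · rintro _ ⟨x, i, rfl⟩ _ rfl
        exact M.comm_A_Q x i
    have hcP : Commute c M.P := by
      refine commute_of_mem_generatedCStar (T := {M.P}) ?_ ?_ c hc _ rfl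
      · rintro _ rfl
        exact M.projP.isSelfAdjoint
      · rintro _ ⟨z, k, rfl⟩ _ rfl
        exact (M.comm_P_C z k).symm
    have h1 : c ψ = M.P (c ψ) := by
      conv_lhs => rw [← hPψ]
      exact congrArg (fun T : M.H →L[ℂ] M.H ↦ T ψ) hcP.eq
    have h2 (u : M.H) : inner ℂ ψ (a u) = inner ℂ ψ (a (M.Q u)) := by
      conv_lhs => rw [← hQψ]
      rw [inner_star_left, M.projQ.isSelfAdjoint.star_eq]
      exact congrArg (fun T : M.H →L[ℂ] M.H ↦ (inner ℂ ψ (T u) : ℂ)) haQ.eq.symm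
    rw [hρ, hρ, hρ, mul_apply_eq_comp, h2, h1, ← mul_apply_eq_comp M.Q, ← M.comm_P_Q.eq, hPQ,
      InnerProductSpace.rankOne_apply, map_smul, inner_smul_right, mul_comm, ← h1]
  · have h := M.prob i j k x y z
    rw [hPQ] at h
    rw [hρ]
    exact h.unique (hasTrace_rankOne_mul _ _)

end Forward

/-! ### Finite-dimensional realizations -/

section FiniteDimensional

/-- The operator with a given matrix with respect to an orthonormal basis. -/
def matrixOp {ι : Type*} [Fintype ι] [DecidableEq ι] {H : Type u} [NormedAddCommGroup H]
    [InnerProductSpace ℂ H] [CompleteSpace H] (b : OrthonormalBasis ι ℂ H) :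
    Matrix ι ι ℂ ≃⋆ₐ[ℂ] (H →L[ℂ] H) :=
  (Matrix.toEuclideanCLM (n := ι) (𝕜 := ℂ)).trans b.repr.symm.conjStarAlgEquiv

theorem inner_matrixOp {ι : Type*} [Fintype ι] [DecidableEq ι] {H : Type u} [NormedAddCommGroup H]
    [InnerProductSpace ℂ H] [CompleteSpace H] (b : OrthonormalBasis ι ℂ H) (M : Matrix ι ι ℂ)
    (i j : ι) : inner ℂ (b i) (matrixOp b M (b j)) = M i j := by
  have h := b.repr.inner_map_map (b i) (matrixOp b M (b j))
  have hM : b.repr (matrixOp b M (b j)) =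
      Matrix.toEuclideanCLM (n := ι) (𝕜 := ℂ) M (b.repr (b j)) := b.repr.apply_symm_apply _
  rw [← h, hM, b.repr_self, b.repr_self, EuclideanSpace.inner_single_left,
    Matrix.ofLp_toEuclideanCLM]
  simp

theorem isPOVM_matrixOp {ι : Type*} [Fintype ι] [DecidableEq ι] {H : Type u} [NormedAddCommGroup H]
    [InnerProductSpace ℂ H] [CompleteSpace H] (b : OrthonormalBasis ι ℂ H) {κ : Type v} [Fintype κ]
    {M : κ → Matrix ι ι ℂ} (hM : ∀ k, (M k).PosSemidef) (hsum : ∑ k, M k = 1) :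
    IsPOVM fun k ↦ matrixOp b (M k) := by
  refine ⟨fun k ↦ ?_, by rw [← map_sum, hsum, map_one]⟩
  obtain ⟨c, hc⟩ := exists_eq_star_mul_self_of_posSemidef (hM k)
  exact ⟨matrixOp b c, by dsimp only; rw [hc, map_mul, map_star]⟩

variable {E F : Type u} [NormedAddCommGroup E] [InnerProductSpace ℂ E] [CompleteSpace E]
  [NormedAddCommGroup F] [InnerProductSpace ℂ F] [CompleteSpace F]

/-- The orthonormal basis `e i ⊗ f j` of a finite-dimensional Hilbert space tensor product. -/
def orthonormalBasisTensor {ι κ : Type*} [Fintype ι] [Fintype κ] (e : OrthonormalBasis ι ℂ E)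
    (f : OrthonormalBasis κ ℂ F) : OrthonormalBasis (ι × κ) ℂ (HTensor E F) :=
  (hilbertBasisTensor e.toHilbertBasis f.toHilbertBasis).toOrthonormalBasis

theorem orthonormalBasisTensor_apply {ι κ : Type*} [Fintype ι] [Fintype κ]
    (e : OrthonormalBasis ι ℂ E) (f : OrthonormalBasis κ ℂ F) (q : ι × κ) :
    orthonormalBasisTensor e f q = tprod (e q.1) (f q.2) := by
  rw [orthonormalBasisTensor, HilbertBasis.coe_toOrthonormalBasis, hilbertBasisTensor_apply,
    OrthonormalBasis.coe_toHilbertBasis, OrthonormalBasis.coe_toHilbertBasis]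

instance finiteDimensional_HTensor [FiniteDimensional ℂ E] [FiniteDimensional ℂ F] :
    FiniteDimensional ℂ (HTensor E F) :=
  (orthonormalBasisTensor (stdOrthonormalBasis ℂ E)
    (stdOrthonormalBasis ℂ F)).toBasis.finiteDimensional_of_finite

theorem mem_span_rankOne {H ι : Type*} [NormedAddCommGroup H] [InnerProductSpace ℂ H] [Fintype ι]
    (b : OrthonormalBasis ι ℂ H) (T : H →L[ℂ] H) :
    T ∈ Submodule.span ℂ {R | ∃ i j, R = InnerProductSpace.rankOne ℂ (b i) (b j)} := by
  have hT : T = ∑ j, ∑ i, (inner ℂ (b i) (T (b j)) : ℂ) •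
      InnerProductSpace.rankOne ℂ (b i) (b j) := by
    refine ContinuousLinearMap.coe_injective (b.toBasis.ext fun k ↦ ?_)
    simp only [OrthonormalBasis.coe_toBasis, ContinuousLinearMap.coe_coe, _root_.sum_apply,
      _root_.smul_apply, InnerProductSpace.rankOne_apply]
    classical
    rw [Finset.sum_eq_single k]
    · simp only [orthonormal_iff_ite.1 b.orthonormal, if_true, one_smul]
      exact (b.sum_repr' _).symm
    · intro j _ hj
      simp [orthonormal_iff_ite.1 b.orthonormal, hj]
    · simp
  rw [hT]
  exact sum_mem fun j _ ↦ sum_mem fun i _ ↦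
    Submodule.smul_mem _ _ (Submodule.subset_span ⟨i, j, rfl⟩)

/-- The matrix units of a product basis are tensor products of matrix units. -/
theorem mem_span_opTensor [FiniteDimensional ℂ E] [FiniteDimensional ℂ F]
    (T : HTensor E F →L[ℂ] HTensor E F) :
    T ∈ Submodule.span ℂ {S | ∃ (f : E →L[ℂ] E) (g : F →L[ℂ] F), S = opTensor f g} := by
  let e := stdOrthonormalBasis ℂ E
  let f := stdOrthonormalBasis ℂ F
  refine Submodule.span_mono ?_ (mem_span_rankOne (orthonormalBasisTensor e f) T)
  rintro _ ⟨q, r, rfl⟩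
  refine ⟨InnerProductSpace.rankOne ℂ (e q.1) (e r.1), InnerProductSpace.rankOne ℂ (f q.2) (f r.2),
    ?_⟩
  rw [opTensor_rankOne, orthonormalBasisTensor_apply, orthonormalBasisTensor_apply]

theorem isClosed_of_finiteDimensional [FiniteDimensional ℂ E] (𝒜 : StarSubalgebra ℂ (E →L[ℂ] E)) :
    IsClosed (𝒜 : Set (E →L[ℂ] E)) :=
  𝒜.toSubalgebra.toSubmodule.closed_of_finiteDimensional

theorem map_mem_span_of_opTensor [FiniteDimensional ℂ E] [FiniteDimensional ℂ F] {H : Type u}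
    [NormedAddCommGroup H] [InnerProductSpace ℂ H] [CompleteSpace H]
    (φ : (HTensor E F →L[ℂ] HTensor E F) →⋆ₐ[ℂ] (H →L[ℂ] H)) {T : Set (H →L[ℂ] H)}
    (h : ∀ f g, φ (opTensor f g) ∈ T) (b : HTensor E F →L[ℂ] HTensor E F) :
    φ b ∈ Submodule.span ℂ T := by
  have hb := mem_span_opTensor b
  induction hb using Submodule.span_induction with
  | mem x hx =>
    obtain ⟨f, g, rfl⟩ := hx
    exact Submodule.subset_span (h f g)
  | zero => rw [map_zero]; exact Submodule.zero_mem _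
  | add x y _ _ hx hy => rw [map_add]; exact Submodule.add_mem _ hx hy
  | smul r x _ hx => rw [map_smul]; exact Submodule.smul_mem _ _ hx

theorem opTensorMiddle_mem_span [FiniteDimensional ℂ E] [FiniteDimensional ℂ F]
    (b : HTensor E F →L[ℂ] HTensor E F) :
    opTensorMiddle (1 : E →L[ℂ] E) b (1 : F →L[ℂ] F) ∈
      Submodule.span ℂ {S | ∃ a ∈ (opRight E (F := E)).range,
        ∃ b ∈ (opLeft F (E := F)).range, S = opTensor a b} := by
  refine map_mem_span_of_opTensor (opMiddle (F := E) (G := F) E F) ?_ b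
  exact fun f g ↦
    ⟨opRight E f, ⟨f, rfl⟩, opLeft F g, ⟨g, rfl⟩, opTensorMiddle_opTensor 1 f g 1⟩

theorem isDensityOperator_rankOne {ψ : E} (hψ : ‖ψ‖ = 1) :
    IsDensityOperator (InnerProductSpace.rankOne ℂ ψ ψ) := by
  refine ⟨ContinuousLinearMap.IsPositive.of_isStarProjection
    (InnerProductSpace.isStarProjection_rankOne_self hψ), ?_⟩
  have h := hasTrace_rankOne_mul ψ 1
  rwa [mul_one, one_apply_eq_self, inner_self_eq_norm_sq_to_K, hψ, RCLike.ofReal_one, one_pow] at h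

/-- The vector `∑ r, a r • e r ⊗ e r`. -/
def schmidtVector {ι : Type*} [Fintype ι] (e : OrthonormalBasis ι ℂ E) (a : ι → ℝ) : HTensor E E :=
  ∑ r, (a r : ℂ) • tprod (e r) (e r)

omit [CompleteSpace E] in
theorem norm_schmidtVector {ι : Type*} [Fintype ι] (e : OrthonormalBasis ι ℂ E) {a : ι → ℝ}
    (ha : ∑ r, a r ^ 2 = 1) : ‖schmidtVector e a‖ = 1 := by
  classical
  have h : (inner ℂ (schmidtVector e a) (schmidtVector e a) : ℂ) = 1 := by
    simp only [schmidtVector, sum_inner, inner_sum, inner_smul_left, inner_smul_right, inner_tprod,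
      orthonormal_iff_ite.1 e.orthonormal, Complex.conj_ofReal]
    have : ∑ r, ((a r : ℂ) * (a r : ℂ)) = 1 := by
      rw [← Complex.ofReal_one, ← ha]
      push_cast
      simp only [sq]
    simpa using this
  rw [inner_self_eq_norm_sq_to_K] at h
  have h' : ‖schmidtVector e a‖ ^ 2 = 1 := by
    rw [← RCLike.ofReal_pow] at h
    exact Complex.ofReal_eq_one.1 h
  exact (pow_eq_one_iff_of_nonneg (norm_nonneg _) two_ne_zero).1 h'

end FiniteDimensional

/-! ### Construction of the five finite-dimensional models. -/

section Backward

variable {X Y Z α β γ : Type v} [Fintype α] [Fintype β] [Fintype γ]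
  {p : α → β → γ → X → Y → Z → ℝ}

/-- A finite-dimensional realization by two pure states on `E ⊗ E` and `F ⊗ F`. -/
structure PureModel (p : α → β → γ → X → Y → Z → ℝ) where
  E : Type u
  F : Type u
  [normE : NormedAddCommGroup E]
  [innerE : InnerProductSpace ℂ E]
  [completeE : CompleteSpace E]
  [finiteE : FiniteDimensional ℂ E]
  [normF : NormedAddCommGroup F]
  [innerF : InnerProductSpace ℂ F]
  [completeF : CompleteSpace F]
  [finiteF : FiniteDimensional ℂ F]
  A : X → α → (E →L[ℂ] E)
  B : Y → β → (HTensor E F →L[ℂ] HTensor E F)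
  C : Z → γ → (F →L[ℂ] F)
  povmA : ∀ x, IsPOVM (A x)
  povmB : ∀ y, IsPOVM (B y)
  povmC : ∀ z, IsPOVM (C z)
  ψ : HTensor E E
  φ : HTensor F F
  norm_ψ : ‖ψ‖ = 1
  norm_φ : ‖φ‖ = 1
  prob : ∀ i j k x y z, (p i j k x y z : ℂ) =
    inner ℂ (tprod ψ φ) (opTensorMiddle (A x i) (B y j) (C z k) (tprod ψ φ))

attribute [instance] PureModel.normE PureModel.innerE PureModel.completeE PureModel.finiteE
  PureModel.normF PureModel.innerF PureModel.completeF PureModel.finiteF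

theorem HasMatrixRealization.nonempty_pureModel (h : HasMatrixRealization p) :
    Nonempty (PureModel.{u} p) := by
  obtain ⟨m, n, A, B, C, a, b, hA, hA1, hB, hB1, hC, hC1, ha, hb, hp⟩ := h
  -- `ULift` places the Hilbert space in the universe required by the models.
  let e : OrthonormalBasis (Fin m) ℂ (EuclideanSpace ℂ (ULift.{u} (Fin m))) :=
    (EuclideanSpace.basisFun _ ℂ).reindex Equiv.ulift
  let f : OrthonormalBasis (Fin n) ℂ (EuclideanSpace ℂ (ULift.{u} (Fin n))) :=
    (EuclideanSpace.basisFun _ ℂ).reindex Equiv.ulift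
  refine ⟨{
    E := EuclideanSpace ℂ (ULift.{u} (Fin m))
    F := EuclideanSpace ℂ (ULift.{u} (Fin n))
    A := fun x i ↦ matrixOp e (A x i)
    B := fun y j ↦ matrixOp (orthonormalBasisTensor e f) (B y j)
    C := fun z k ↦ matrixOp f (C z k)
    povmA := fun x ↦ isPOVM_matrixOp e (hA x) (hA1 x)
    povmB := fun y ↦ isPOVM_matrixOp (orthonormalBasisTensor e f) (hB y) (hB1 y)
    povmC := fun z ↦ isPOVM_matrixOp f (hC z) (hC1 z)
    ψ := schmidtVector e a
    φ := schmidtVector f b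
    norm_ψ := norm_schmidtVector e ha
    norm_φ := norm_schmidtVector f hb
    prob := fun i j k x y z ↦ ?_ }⟩
  have hvec : tprod (schmidtVector e a) (schmidtVector f b) =
      ∑ q : Fin m × Fin n, ((a q.1 * b q.2 : ℝ) : ℂ) •
        tprod (tprod (e q.1) (e q.1)) (tprod (f q.2) (f q.2)) := by
    rw [schmidtVector, schmidtVector, tprod_sum_left, Fintype.sum_prod_type]
    refine Finset.sum_congr rfl fun r _ ↦ ?_
    rw [tprod_sum_right]
    refine Finset.sum_congr rfl fun s _ ↦ ?_
    rw [tprod_smul_left, tprod_smul_right, smul_smul, Complex.ofReal_mul]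
  have hB' (q q' : Fin m × Fin n) : inner ℂ (tprod (e q.1) (f q.2))
      (matrixOp (orthonormalBasisTensor e f) (B y j) (tprod (e q'.1) (f q'.2))) = B y j q q' := by
    rw [← orthonormalBasisTensor_apply e f q, ← orthonormalBasisTensor_apply e f q',
      inner_matrixOp]
  rw [hvec, hp, sum_inner]
  refine Finset.sum_congr rfl fun q _ ↦ ?_
  rw [map_sum, inner_sum]
  refine Finset.sum_congr rfl fun q' _ ↦ ?_
  rw [map_smul, inner_smul_left, inner_smul_right, Complex.conj_ofReal, inner_opTensorMiddle,
    inner_matrixOp, inner_matrixOp, hB']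
  push_cast
  ring

theorem PureModel.hasTrace (M : PureModel.{u} p) (i : α) (j : β) (k : γ) (x : X) (y : Y) (z : Z) :
    HasTrace (opTensor (InnerProductSpace.rankOne ℂ M.ψ M.ψ) (InnerProductSpace.rankOne ℂ M.φ M.φ) *
      opTensorMiddle (M.A x i) (M.B y j) (M.C z k)) (p i j k x y z : ℂ) := by
  rw [M.prob, opTensor_rankOne]
  exact hasTrace_rankOne_mul _ _

theorem PureModel.exists_tensorModel (M : PureModel.{u} p) :
    ∃ N : TensorModel.{u} p, N.IsFinite :=
  ⟨{  HA := M.E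
      HBA := M.E
      HBC := M.F
      HC := M.F
      A := M.A
      B := M.B
      C := M.C
      povmA := M.povmA
      povmB := M.povmB
      povmC := M.povmC
      B_mem := fun y j ↦ by
        refine subset_closure ⟨M.B y j, ?_, rfl⟩
        simpa using mem_span_opTensor (M.B y j)
      σAB := InnerProductSpace.rankOne ℂ M.ψ M.ψ
      σBC := InnerProductSpace.rankOne ℂ M.φ M.φ
      densityAB := isDensityOperator_rankOne M.norm_ψ
      densityBC := isDensityOperator_rankOne M.norm_φ
      prob := M.hasTrace }, M.finiteE, M.finiteE, M.finiteF, M.finiteF⟩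

-- Alice and Bob act on the two legs of `E ⊗ E`, Bob and Charlie on those of `F ⊗ F`. Purity of the
-- two states is recorded because the Renou–Xu projections are built from their vectors.
set_option maxHeartbeats 1000000 in
theorem PureModel.exists_mixedModel (M : PureModel.{u} p) :
    ∃ N : MixedModel.{u} p, N.IsFinite ∧
      (∃ ψ, ‖ψ‖ = 1 ∧ N.σAB = InnerProductSpace.rankOne ℂ ψ ψ) ∧
      ∃ φ, ‖φ‖ = 1 ∧ N.σBC = InnerProductSpace.rankOne ℂ φ φ :=
  ⟨{  HAB := HTensor M.E M.E
      HBC := HTensor M.F M.F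
      𝒜 := (opLeft M.E).range
      ℬA := (opRight M.E).range
      ℬC := (opLeft M.F).range
      𝒞 := (opRight M.F).range
      closedA := isClosed_of_finiteDimensional _
      closedBA := isClosed_of_finiteDimensional _
      closedBC := isClosed_of_finiteDimensional _
      closedC := isClosed_of_finiteDimensional _
      comm_A_BA := by
        rintro _ ⟨a, rfl⟩ _ ⟨b, rfl⟩
        exact commute_opTensor a b
      comm_BC_C := by
        rintro _ ⟨b, rfl⟩ _ ⟨c, rfl⟩
        exact commute_opTensor b c
      A := fun x i ↦ opLeft M.E (M.A x i)
      B := fun y j ↦ opMiddle M.E M.F (M.B y j)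
      C := fun z k ↦ opRight M.F (M.C z k)
      povmA := fun x ↦ (M.povmA x).map_operators (opLeft M.E)
      povmB := fun y ↦ (M.povmB y).map_operators (opMiddle M.E M.F)
      povmC := fun z ↦ (M.povmC z).map_operators (opRight M.F)
      A_mem := fun x i ↦ ⟨M.A x i, rfl⟩
      B_mem := fun y j ↦ subset_closure ⟨_, opTensorMiddle_mem_span (M.B y j), rfl⟩
      C_mem := fun z k ↦ ⟨M.C z k, rfl⟩
      σAB := InnerProductSpace.rankOne ℂ M.ψ M.ψ
      σBC := InnerProductSpace.rankOne ℂ M.φ M.φ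
      densityAB := isDensityOperator_rankOne M.norm_ψ
      densityBC := isDensityOperator_rankOne M.norm_φ
      prob := fun i j k x y z ↦ by
        have h := M.hasTrace i j k x y z
        rw [opTensorMiddle_eq] at h
        exact h },
    ⟨finiteDimensional_HTensor (E := M.E) (F := M.E),
      finiteDimensional_HTensor (E := M.F) (F := M.F)⟩,
    ⟨M.ψ, M.norm_ψ, rfl⟩, ⟨M.φ, M.norm_φ, rfl⟩⟩

/-- In finite dimension the span is already closed in the weak operator topology. -/
theorem mem_span_of_mem_vonNeumannTensor {E F : Type u} [NormedAddCommGroup E]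
    [InnerProductSpace ℂ E] [CompleteSpace E] [NormedAddCommGroup F] [InnerProductSpace ℂ F]
    [CompleteSpace F] [FiniteDimensional ℂ E] [FiniteDimensional ℂ F]
    {𝒜 : StarSubalgebra ℂ (E →L[ℂ] E)} {ℬ : StarSubalgebra ℂ (F →L[ℂ] F)}
    {T : HTensor E F →L[ℂ] HTensor E F} (hT : T ∈ vonNeumannTensor 𝒜 ℬ) :
    T ∈ Submodule.span ℂ {S | ∃ a ∈ 𝒜, ∃ b ∈ ℬ, S = opTensor a b} := by
  let W := Submodule.span ℂ {S : HTensor E F →L[ℂ] HTensor E F |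
    ∃ a ∈ 𝒜, ∃ b ∈ ℬ, S = opTensor a b}
  let ι : (HTensor E F →L[ℂ] HTensor E F) →ₗ[ℂ] (HTensor E F →WOT[ℂ] HTensor E F) :=
    (ContinuousLinearMap.WOTofCLM (σ := RingHom.id ℂ)).toLinearMap
  have hcl : IsClosed (W.map ι : Set (HTensor E F →WOT[ℂ] HTensor E F)) :=
    (W.map ι).closed_of_finiteDimensional
  obtain ⟨S, hS, hST⟩ := hcl.closure_subset_iff.2 le_rfl hT
  have : S = T := ContinuousLinearMapWOT.ofCLM_injective hST
  exact this ▸ hS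

theorem CommutingModel.exists_reducedModel (M : CommutingModel.{u} p) (hM : M.IsFinite) :
    ∃ N : ReducedModel.{u} p, N.IsFinite :=
  ⟨{  D := M.D
      𝒜 := M.𝒜
      ℬ := generatedCStar ((M.ℬA : Set M.D) ∪ M.ℬC)
      𝒞 := M.𝒞
      closedA := M.closedA
      closedB := isClosed_generatedCStar _
      closedC := M.closedC
      comm_A_B := fun a ha b hb ↦ by
        refine (commute_of_mem_generatedCStar (T := (M.𝒜 : Set M.D)) (fun t ht ↦ star_mem ht) ?_ _
          hb _ ha).symm
        rintro s (hs | hs) t ht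
        · exact (M.comm_A_BA t ht s hs).symm
        · exact (M.comm_A_BC t ht s hs).symm
      comm_A_C := M.comm_A_C
      comm_B_C := by
        refine commute_of_mem_generatedCStar (T := (M.𝒞 : Set M.D)) (fun t ht ↦ star_mem ht) ?_
        rintro s (hs | hs) t ht
        · exact M.comm_BA_C s hs t ht
        · exact M.comm_BC_C s hs t ht
      A := M.A
      B := M.B
      C := M.C
      povmA := M.povmA
      povmB := M.povmB
      povmC := M.povmC
      A_mem := M.A_mem
      B_mem := M.B_mem
      C_mem := M.C_mem
      ρ := M.ρ
      state := M.state
      factor := fun a ha c hc ↦ by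
        simpa only [mul_one, one_mul] using M.factor a ha 1 (one_mem _) 1 (one_mem _) c hc
      prob := M.prob }, hM⟩

theorem mem_generatedCStar_of_mem_vonNeumannTensor {E F : Type u} [NormedAddCommGroup E]
    [InnerProductSpace ℂ E] [CompleteSpace E] [NormedAddCommGroup F] [InnerProductSpace ℂ F]
    [CompleteSpace F] [FiniteDimensional ℂ E] [FiniteDimensional ℂ F]
    {𝒜 : StarSubalgebra ℂ (E →L[ℂ] E)} {ℬ : StarSubalgebra ℂ (F →L[ℂ] F)}
    {T : HTensor E F →L[ℂ] HTensor E F} (hT : T ∈ vonNeumannTensor 𝒜 ℬ) :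
    T ∈ generatedCStar (R := HTensor E F →L[ℂ] HTensor E F)
      (((𝒜.map (opLeft F (E := E)) : StarSubalgebra ℂ (HTensor E F →L[ℂ] HTensor E F)) :
        Set (HTensor E F →L[ℂ] HTensor E F)) ∪
        ((ℬ.map (opRight E (F := F)) : StarSubalgebra ℂ (HTensor E F →L[ℂ] HTensor E F)) :
        Set (HTensor E F →L[ℂ] HTensor E F))) := by
  set 𝒟 := generatedCStar (R := HTensor E F →L[ℂ] HTensor E F) _
  refine Submodule.span_le (p := 𝒟.toSubalgebra.toSubmodule).2 ?_
    (mem_span_of_mem_vonNeumannTensor hT)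
  rintro _ ⟨a, ha, b, hb, rfl⟩
  have h : opTensor a b = opTensor a 1 * opTensor 1 b := by
    rw [← opTensor_mul, mul_one, one_mul]
  have h₁ : opTensor a 1 ∈ 𝒟 := subset_generatedCStar _ (Or.inl ⟨a, ha, rfl⟩)
  have h₂ : opTensor 1 b ∈ 𝒟 := subset_generatedCStar _ (Or.inr ⟨b, hb, rfl⟩)
  rw [h]
  exact (mul_mem h₁ h₂ : _ ∈ 𝒟)

theorem exists_commutingModel_of_representations {E G H : Type u}
    [NormedAddCommGroup E] [InnerProductSpace ℂ E] [CompleteSpace E]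
    [NormedAddCommGroup G] [InnerProductSpace ℂ G] [CompleteSpace G]
    [NormedAddCommGroup H] [InnerProductSpace ℂ H] [CompleteSpace H] [FiniteDimensional ℂ H]
    (φ : (E →L[ℂ] E) →⋆ₐ[ℂ] (H →L[ℂ] H)) (ψ : (G →L[ℂ] G) →⋆ₐ[ℂ] (H →L[ℂ] H))
    (hφψ : ∀ a c, Commute (φ a) (ψ c))
    {𝒜 ℬA : StarSubalgebra ℂ (E →L[ℂ] E)} {ℬC 𝒞 : StarSubalgebra ℂ (G →L[ℂ] G)}
    (hA : MutuallyCommute (𝒜 : Set (E →L[ℂ] E)) (ℬA : Set (E →L[ℂ] E)))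
    (hC : MutuallyCommute (ℬC : Set (G →L[ℂ] G)) (𝒞 : Set (G →L[ℂ] G)))
    {A : X → α → (E →L[ℂ] E)} {B : Y → β → (H →L[ℂ] H)} {C : Z → γ → (G →L[ℂ] G)}
    (povmA : ∀ x, IsPOVM (A x)) (povmB : ∀ y, IsPOVM (B y)) (povmC : ∀ z, IsPOVM (C z))
    (A_mem : ∀ x i, A x i ∈ 𝒜)
    (B_mem : ∀ y j, B y j ∈ generatedCStar (R := H →L[ℂ] H)
      ((ℬA.map φ : Set (H →L[ℂ] H)) ∪ (ℬC.map ψ : Set (H →L[ℂ] H))))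
    (C_mem : ∀ z k, C z k ∈ 𝒞)
    {ρ : (H →L[ℂ] H) →ₗ[ℂ] ℂ} (hρ : IsState (R := H →L[ℂ] H) ρ)
    (hfac : ∀ a c, ρ (φ a * ψ c) = ρ (φ a) * ρ (ψ c))
    (hp : ∀ i j k x y z, (p i j k x y z : ℂ) = ρ (φ (A x i) * B y j * ψ (C z k))) :
    ∃ N : CommutingModel.{u} p, N.IsFinite :=
  ⟨{
    D := H →L[ℂ] H
    𝒜 := 𝒜.map φ
    ℬA := ℬA.map φ
    ℬC := ℬC.map ψ
    𝒞 := 𝒞.map ψ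
    closedA := isClosed_of_finiteDimensional _
    closedBA := isClosed_of_finiteDimensional _
    closedBC := isClosed_of_finiteDimensional _
    closedC := isClosed_of_finiteDimensional _
    comm_A_BA := by
      rintro _ ⟨a, ha, rfl⟩ _ ⟨b, hb, rfl⟩
      exact (hA a ha b hb).map φ
    comm_A_BC := by
      rintro _ ⟨a, -, rfl⟩ _ ⟨b, -, rfl⟩
      exact hφψ a b
    comm_A_C := by
      rintro _ ⟨a, -, rfl⟩ _ ⟨b, -, rfl⟩
      exact hφψ a b
    comm_BA_BC := by
      rintro _ ⟨a, -, rfl⟩ _ ⟨b, -, rfl⟩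
      exact hφψ a b
    comm_BA_C := by
      rintro _ ⟨a, -, rfl⟩ _ ⟨b, -, rfl⟩
      exact hφψ a b
    comm_BC_C := by
      rintro _ ⟨b, hb, rfl⟩ _ ⟨c, hc, rfl⟩
      exact (hC b hb c hc).map ψ
    A := fun x i ↦ φ (A x i)
    B := B
    C := fun z k ↦ ψ (C z k)
    povmA := fun x ↦ (povmA x).map φ
    povmB := povmB
    povmC := fun z ↦ (povmC z).map ψ
    A_mem := fun x i ↦ ⟨A x i, A_mem x i, rfl⟩
    B_mem := B_mem
    C_mem := fun z k ↦ ⟨C z k, C_mem z k, rfl⟩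
    ρ := ρ
    state := hρ
    factor := by
      rintro _ ⟨a, -, rfl⟩ _ ⟨b, -, rfl⟩ _ ⟨b', -, rfl⟩ _ ⟨c, -, rfl⟩
      change ρ (φ a * φ b * ψ b' * ψ c) = ρ (φ a * φ b) * ρ (ψ b' * ψ c)
      -- Alice and `ℬA` act through `φ`, `ℬC` and Charlie through `ψ`, so the fourfold product
      -- regroups into one operator on each side.
      rw [mul_assoc, ← map_mul, ← map_mul]
      exact hfac (a * b) (b' * c)
    prob := hp },
    (inferInstance : FiniteDimensional ℂ (H →L[ℂ] H))⟩

theorem MixedModel.exists_commutingModel (M : MixedModel.{u} p) (hM : M.IsFinite) :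
    ∃ N : CommutingModel.{u} p, N.IsFinite := by
  have := hM.1
  have := hM.2
  obtain ⟨ρ, hρ, hρtr, hρprod⟩ := exists_product_state M.densityAB M.densityBC
  exact exists_commutingModel_of_representations (opLeft M.HBC) (opRight M.HAB)
    (fun a c ↦ commute_opTensor a c) M.comm_A_BA M.comm_BC_C M.povmA M.povmB M.povmC M.A_mem
    (fun y j ↦ mem_generatedCStar_of_mem_vonNeumannTensor (M.B_mem y j)) M.C_mem hρ
    (fun a c ↦ hρprod a c) (fun i j k x y z ↦ hρtr _ _ (M.prob i j k x y z))

/-- The projections onto the two state vectors, each extended by the identity on the other factor,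
have a rank-one product exactly because both states are pure. They commute with the opposite outer
party because they act on different factors. -/
theorem MixedModel.exists_renouXuModel (M : MixedModel.{u} p) (hM : M.IsFinite)
    (hAB : ∃ ψ, ‖ψ‖ = 1 ∧ M.σAB = InnerProductSpace.rankOne ℂ ψ ψ)
    (hBC : ∃ φ, ‖φ‖ = 1 ∧ M.σBC = InnerProductSpace.rankOne ℂ φ φ) :
    ∃ N : RenouXuModel.{u} p, N.IsFinite := by
  have := hM.1
  have := hM.2
  obtain ⟨ψ, hψ, hψσ⟩ := hAB
  obtain ⟨φ, hφ, hφσ⟩ := hBC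
  have hPQ : opTensor (InnerProductSpace.rankOne ℂ ψ ψ) 1 *
      opTensor 1 (InnerProductSpace.rankOne ℂ φ φ) =
      opTensor (InnerProductSpace.rankOne ℂ ψ ψ) (InnerProductSpace.rankOne ℂ φ φ) := by
    rw [← opTensor_mul, mul_one, one_mul]
  exact ⟨{
    H := HTensor M.HAB M.HBC
    P := opTensor (InnerProductSpace.rankOne ℂ ψ ψ) 1
    Q := opTensor 1 (InnerProductSpace.rankOne ℂ φ φ)
    projP := (InnerProductSpace.isStarProjection_rankOne_self hψ).map (opLeft M.HBC)
    projQ := (InnerProductSpace.isStarProjection_rankOne_self hφ).map (opRight M.HAB)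
    comm_P_Q := commute_opTensor _ _
    rankOne_PQ := ⟨tprod ψ φ, by rw [norm_tprod, hψ, hφ, mul_one],
      hPQ.trans (opTensor_rankOne ψ ψ φ φ)⟩
    A := fun x i ↦ opLeft M.HBC (M.A x i)
    B := M.B
    C := fun z k ↦ opRight M.HAB (M.C z k)
    povmA := fun x ↦ (M.povmA x).map_operators (opLeft M.HBC)
    povmB := M.povmB
    povmC := fun z ↦ (M.povmC z).map_operators (opRight M.HAB)
    comm_A_B := M.commute_A_B
    comm_A_C := fun x i z k ↦ commute_opTensor (M.A x i) (M.C z k)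
    comm_B_C := M.commute_B_C
    comm_A_Q := fun x i ↦ commute_opTensor (M.A x i) _
    comm_P_C := fun z k ↦ commute_opTensor _ (M.C z k)
    prob := fun i j k x y z ↦ by
      have h := M.prob i j k x y z
      rw [hψσ, hφσ] at h
      rw [hPQ]
      exact h }, finiteDimensional_HTensor (E := M.HAB) (F := M.HBC)⟩

end Backward

end

end Bilocal

/-! ### The main theorem. -/

theorem corollary4 {X Y Z α β γ : Type v} [Finite X] [Finite Y] [Finite Z]
    [Fintype α] [Fintype β] [Fintype γ] (p : α → β → γ → X → Y → Z → ℝ)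
    (h : (∃ M : Bilocal.TensorModel.{u} p, M.OuterFinite) ∨
      (∃ M : Bilocal.CommutingModel.{u} p, M.OuterFinite) ∨
      (∃ M : Bilocal.ReducedModel.{u} p, M.OuterFinite) ∨
      (∃ M : Bilocal.MixedModel.{u} p, M.OuterFinite) ∨
      (∃ M : Bilocal.RenouXuModel.{u} p, M.OuterFinite)) :
    (∃ M : Bilocal.TensorModel.{u} p, M.IsFinite) ∧
      (∃ M : Bilocal.CommutingModel.{u} p, M.IsFinite) ∧
      (∃ M : Bilocal.ReducedModel.{u} p, M.IsFinite) ∧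
      (∃ M : Bilocal.MixedModel.{u} p, M.IsFinite) ∧
      (∃ M : Bilocal.RenouXuModel.{u} p, M.IsFinite) := by
  have hp : Bilocal.HasMatrixRealization p := by
    rcases h with ⟨M, hM⟩ | ⟨M, hM⟩ | ⟨M, hM⟩ | ⟨M, hM⟩ | ⟨M, hM⟩ <;>
      exact M.hasMatrixRealization hM
  obtain ⟨M⟩ := hp.nonempty_pureModel.{u}
  obtain ⟨N, hN, hψ, hφ⟩ := M.exists_mixedModel
  obtain ⟨K, hK⟩ := N.exists_commutingModel hN
  exact ⟨M.exists_tensorModel, ⟨K, hK⟩, K.exists_reducedModel hK, ⟨N, hN⟩,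
    N.exists_renouXuModel hN hψ hφ⟩
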